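/- Fix $d\ge 2$. For $n\ge d+2$ let $K_n^{(d)}$ be the complete $(d+1)$-uniform hypergraph on the vertex set $[n]$, and let $\mathcal S_n^{(d)}$ be the (non-empty) set of sub-hypergraphs $S$ of $K_n^{(d)}$ that cover all $n$ vertices and for which the simplicial complex formed by the downward closure of $E(S)$ is homeomorphic to the sphere $\mathbb S^d$; the hyperedges of $S$ are called its facets. Give the hyperedges $e$ of $K_n^{(d)}$ independent random costs $W_e$, uniformly distributed in $[0,1]$, and let $$M(\mathcal S_n^{(d)})=\min_{S\in\mathcal S_n^{(d)}}\ \sum_{e\in E(S)}W_e ,$$ with median $\mu_n^{(d)}$. Let us say that a real number $\beta$ is a count exponent for $d$ if there is a constant $C$ such that for all $n$ and $m$ at most $2^{Cm}m^{\beta m}$ members of $\mathcal S_n^{(d)}$ have exactly $m$ facets. "With high probability" means with probability tending to $1$ as $n\to\infty$. Then: (i) There is a constant $b=b(d)$ such that $M(\mathcal S_n^{(d)})\le b\,n^{1-1/d}$ with high probability. (ii) If $\beta_d\le 1$ is a count exponent for $d$, then there is a constant $a>0$, independent of $n$, such that $M(\mathcal S_n^{(d)})\ge a\,n^{1-\beta_d}$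 with high probability. (iii) If some $\beta_d<1/2$ is a count exponent for $d$, then there is a constant $c>0$, independent of $n$ and $t$, such that for all $n\ge d+2$ and all $t>0$ $$\Pr\bigl(|M(\mathcal S_n^{(d)})-\mu_n^{(d)}|>t\bigr)\le e^{-ct^2/n}.$$ -/

import Mathlib

open MeasureTheory Filter Topology

noncomputable section

namespace SpanningSphere

/-- The hyperedges of the complete `(d+1)`-uniform hypergraph `K_n^{(d)}` on `n` vertices. -/
abbrev Edge (d n : ℕ) : Type := {e : Finset (Fin n) // e.card = d + 1}

/-- Geometric realization of the simplicial complex that is the downward closure of the set `S`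
of hyperedges: the points of the standard simplex on the `n` vertices (in barycentric coordinates)
whose support is contained in a member of `S`. It carries the subspace topology of `ℝ^n`. -/
def realization {d n : ℕ} (S : Finset (Edge d n)) : Set (Fin n → ℝ) :=
  {x | x ∈ stdSimplex ℝ (Fin n) ∧ ∃ e ∈ S, ∀ v, x v ≠ 0 → v ∈ e.1}

/-- The set of spanning `d`-spheres: sub-hypergraphs (given by their sets of
hyperedges, the facets) covering all `n` vertices, whose downward closure is homeomorphic to the
`d`-dimensional sphere. -/
def spheres (d n : ℕ) : Set (Finset (Edge d n)) :=
  {S | (∀ v : Fin n, ∃ e ∈ S, v ∈ e.1) ∧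
    Nonempty (realization S ≃ₜ Metric.sphere (0 : EuclideanSpace ℝ (Fin (d + 1))) 1)}

/-- The law of the costs: independent and uniform in `[0,1]`, one for each hyperedge. -/
def costLaw (d n : ℕ) : Measure (Edge d n → ℝ) :=
  Measure.pi fun _ => volume.restrict (Set.Icc (0 : ℝ) 1)

/-- The total cost (volume) of a sub-hypergraph. -/
def cost {d n : ℕ} (W : Edge d n → ℝ) (S : Finset (Edge d n)) : ℝ := ∑ e ∈ S, W e

/-- The minimum cost of a spanning sphere (the infimum is over a finite set, so it is
attained as soon as a spanning sphere exists). -/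
def minCost {d n : ℕ} (W : Edge d n → ℝ) : ℝ := sInf (cost W '' spheres d n)

/-- `μ` is a median of the random variable `X`. -/
def IsMedian {Ω : Type*} [MeasurableSpace Ω] (P : Measure Ω) (X : Ω → ℝ) (μ : ℝ) : Prop :=
  1 / 2 ≤ P.real {ω | X ω ≤ μ} ∧ 1 / 2 ≤ P.real {ω | μ ≤ X ω}

/-- `β` is an admissible count exponent in dimension `d`: at most `2^{O(m)} m^{β m}` spanning
`d`-spheres on `n` labelled vertices have `m` facets, with an implied constant that is uniform
in `n` and `m`. -/
def IsCountExponent (d : ℕ) (β : ℝ) : Prop :=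
  ∃ C : ℝ, ∀ n m : ℕ,
    (({S | S ∈ spheres d n ∧ S.card = m} : Set (Finset (Edge d n))).ncard : ℝ)
      ≤ (2 : ℝ) ^ (C * m) * (m : ℝ) ^ (β * m)

end SpanningSphere

end

/-! Upper bound. Begin with the boundary of a (d+1)-simplex and insert the other vertices one at a
time by stellar subdivision of a single "open" facet F. Subdividing at v creates d+1 facets; one of
them stays open and the other d are paid for. With r vertices left, each candidate v has all d
prices at most s with probability s^d, independently of the other candidates, so the cheapest step
costs about r^(-1/d), and these costs sum to order n^(1-1/d). The rule for the next open facet makes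
the steps use fresh costs: every facet bought contains the least vertex of F (the pivot), and the
pivot is then dropped for good. Hence the exponential moments of the steps multiply
(`lintegral_iInf_mul_le`, `lintegral_insertionValue_le`) and Markov's inequality finishes.

Lower bound. A sum of m independent uniform costs is at most s with probability at most (e s/m)^m
(`cost_lower_tail`). A union bound over spheres, grouped by facet number m ≥ n/(d+1), beats the
count 2^(Cm) m^(βm) once s is a small multiple of n^(1-β).

Concentration. The square root of the cost of S is the Euclidean norm of the vector of √W_e over S,
so √`minCost` is 1-Lipschitz in √W. A Prékopa–Leindler argument for the density 2u of √W_e gives a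
dimension-free isoperimetric inequality in that metric (`measure_pi_unif_mul_le`). Deterministically
`minCost` ≤ d n (`minCost_le_mul`), so a deviation t of `minCost` moves its root by order t/√n. -/

namespace SpanningSphere

/-! ### Stellar subdivision of a facet preserves the homeomorphism type. -/

/-- The hyperedge obtained from `F` by replacing the vertex `u` by `v`
(with junk value `F` unless `u ∈ F` and `v ∉ F.erase u`). -/
def swap {d n : ℕ} (F : Edge d n) (u v : Fin n) : Edge d n :=
  if h : (insert v (F.1.erase u)).card = d + 1 then ⟨insert v (F.1.erase u), h⟩ else F

theorem swap_val {d n : ℕ} {F : Edge d n} {u v : Fin n} (hu : u ∈ F.1) (hv : v ∉ F.1) :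
    (swap F u v).1 = insert v (F.1.erase u) := by
  have h : (insert v (F.1.erase u)).card = d + 1 := by
    rw [Finset.card_insert_of_notMem (by simp [hv]), Finset.card_erase_of_mem hu, F.2]; rfl
  simp [swap, h]

theorem swap_injOn {d n : ℕ} {F : Edge d n} {v : Fin n} (hv : v ∉ F.1) :
    Set.InjOn (fun u => swap F u v) (F.1 : Set (Fin n)) := by
  intro u hu u' hu' h
  have hu : u ∈ F.1 := hu
  have hu' : u' ∈ F.1 := hu'
  have h2 := congrArg Subtype.val h
  simp only [swap_val hu hv, swap_val hu' hv] at h2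
  by_contra hne
  have : u ∈ insert v (F.1.erase u') := by simp [hu, hne]
  rw [← h2] at this
  simp only [Finset.mem_insert, Finset.mem_erase, ne_eq, not_true_eq_false, false_and,
    or_false] at this
  exact hv (this ▸ hu)

/-- Stellar subdivision of the facet `F` of `S` at a new vertex `v`. -/
def subdivide {d n : ℕ} (S : Finset (Edge d n)) (F : Edge d n) (v : Fin n) : Finset (Edge d n) :=
  S.erase F ∪ F.1.image fun u => swap F u v

theorem edge_nonempty {d n : ℕ} (F : Edge d n) : F.1.Nonempty :=
  Finset.card_pos.1 (by rw [F.2]; omega)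

theorem exists_mem_notMem_of_ne {d n : ℕ} {F e : Edge d n} (h : e ≠ F) : ∃ u ∈ F.1, u ∉ e.1 := by
  by_contra! hc
  exact h (Subtype.ext (Finset.eq_of_subset_of_card_le hc (by rw [F.2, e.2])).symm)

/-- The smallest barycentric coordinate on the face `F`. -/
def minCoord {d n : ℕ} (F : Edge d n) (y : Fin n → ℝ) : ℝ := F.1.inf' (edge_nonempty F) y

theorem minCoord_le {d n : ℕ} {F : Edge d n} {u : Fin n} (hu : u ∈ F.1) (y : Fin n → ℝ) :
    minCoord F y ≤ y u := Finset.inf'_le _ hu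

theorem exists_minCoord_eq {d n : ℕ} (F : Edge d n) (y : Fin n → ℝ) :
    ∃ u ∈ F.1, minCoord F y = y u := Finset.exists_mem_eq_inf' _ _

theorem continuous_minCoord {d n : ℕ} (F : Edge d n) : Continuous (minCoord F) :=
  Continuous.finset_inf'_apply _ fun i _ => continuous_apply i

theorem minCoord_eq_zero {d n : ℕ} {F : Edge d n} {y : Fin n → ℝ} (hy : ∀ w, 0 ≤ y w)
    {u : Fin n} (hu : u ∈ F.1) (h0 : y u = 0) : minCoord F y = 0 := by
  obtain ⟨w, hw, h⟩ := exists_minCoord_eq F y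
  exact le_antisymm (h0 ▸ minCoord_le hu y) (h ▸ hy w)

/-- Piecewise linear map onto the subdivision of `F` at `v`. -/
def toSubdivision {d n : ℕ} (F : Edge d n) (v : Fin n) (y : Fin n → ℝ) : Fin n → ℝ :=
  fun w => if w ∈ F.1 then y w - minCoord F y else if w = v then (d + 1) * minCoord F y else y w

/-- Linear map sending the vertex `v` to the barycentre of `F`. -/
noncomputable def ofSubdivision {d n : ℕ} (F : Edge d n) (v : Fin n) (x : Fin n → ℝ) : Fin n → ℝ :=
  fun w => if w ∈ F.1 then x w + x v / (d + 1) else if w = v then 0 else x w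

theorem continuous_toSubdivision {d n : ℕ} (F : Edge d n) (v : Fin n) :
    Continuous (toSubdivision F v) := by
  refine continuous_pi fun w => ?_
  have := continuous_minCoord F
  unfold toSubdivision
  split_ifs <;> fun_prop

theorem continuous_ofSubdivision {d n : ℕ} (F : Edge d n) (v : Fin n) :
    Continuous (ofSubdivision F v) := by
  refine continuous_pi fun w => ?_
  unfold ofSubdivision
  split_ifs <;> fun_prop

theorem sum_split {d n : ℕ} (F : Edge d n) {v : Fin n} (hv : v ∉ F.1) (y : Fin n → ℝ) :
    ∑ w, y w = ∑ w ∈ F.1, y w + (y v + ∑ w ∈ (Finset.univ \ F.1).erase v, y w) := by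
  rw [Finset.add_sum_erase _ _ (by simp [hv]), add_comm, Finset.sum_sdiff (Finset.subset_univ _)]

theorem sum_toSubdivision {d n : ℕ} (F : Edge d n) {v : Fin n} (hv : v ∉ F.1) (y : Fin n → ℝ)
    (hy : y v = 0) : ∑ w, toSubdivision F v y w = ∑ w, y w := by
  rw [sum_split F hv, sum_split F hv y]
  have h1 : ∑ w ∈ F.1, toSubdivision F v y w = ∑ w ∈ F.1, y w - (d + 1) * minCoord F y := by
    rw [Finset.sum_congr rfl (g := fun w => y w - minCoord F y)
      (fun w hw => by simp [toSubdivision, hw])]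
    simp [Finset.sum_sub_distrib, F.2]
  have h2 : ∑ w ∈ (Finset.univ \ F.1).erase v, toSubdivision F v y w =
      ∑ w ∈ (Finset.univ \ F.1).erase v, y w := by
    refine Finset.sum_congr rfl fun w hw => ?_
    simp only [Finset.mem_erase, Finset.mem_sdiff, Finset.mem_univ, true_and] at hw
    simp [toSubdivision, hw.1, hw.2]
  have h3 : toSubdivision F v y v = (d + 1) * minCoord F y := by simp [toSubdivision, hv]
  rw [h1, h2, h3, hy]
  ring

theorem sum_ofSubdivision {d n : ℕ} (F : Edge d n) {v : Fin n} (hv : v ∉ F.1) (x : Fin n → ℝ) :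
    ∑ w, ofSubdivision F v x w = ∑ w, x w := by
  rw [sum_split F hv, sum_split F hv x]
  have h1 : ∑ w ∈ F.1, ofSubdivision F v x w = ∑ w ∈ F.1, x w + x v := by
    rw [Finset.sum_congr rfl (g := fun w => x w + x v / (d + 1))
      (fun w hw => by simp [ofSubdivision, hw])]
    have : (d : ℝ) + 1 ≠ 0 := by positivity
    simp [Finset.sum_add_distrib, F.2]
    field_simp
  have h2 : ∑ w ∈ (Finset.univ \ F.1).erase v, ofSubdivision F v x w =
      ∑ w ∈ (Finset.univ \ F.1).erase v, x w := by
    refine Finset.sum_congr rfl fun w hw => ?_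
    simp only [Finset.mem_erase, Finset.mem_sdiff, Finset.mem_univ, true_and] at hw
    simp [ofSubdivision, hw.1, hw.2]
  rw [h1, h2]
  simp [ofSubdivision, hv]

theorem apply_eq_zero_of_realization {d n : ℕ} {S : Finset (Edge d n)} {v : Fin n}
    (hS : ∀ e ∈ S, v ∉ e.1) {y : Fin n → ℝ} (hy : y ∈ realization S) : y v = 0 := by
  obtain ⟨-, e, he, h⟩ := hy
  by_contra hne
  exact hS e he (h v hne)

theorem toSubdivision_mem {d n : ℕ} {S : Finset (Edge d n)} {F : Edge d n} (hF : F ∈ S)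
    {v : Fin n} (hS : ∀ e ∈ S, v ∉ e.1) {y : Fin n → ℝ} (hy : y ∈ realization S) :
    toSubdivision F v y ∈ realization (subdivide S F v) := by
  have hv0 := apply_eq_zero_of_realization hS hy
  have hvF := hS F hF
  obtain ⟨⟨hnn, hsum⟩, e, he, hsupp⟩ := hy
  have hm : 0 ≤ minCoord F y := by
    obtain ⟨w, -, h⟩ := exists_minCoord_eq F y
    exact h ▸ hnn w
  refine ⟨⟨fun w => ?_, (sum_toSubdivision F hvF y hv0).trans hsum⟩, ?_⟩
  · unfold toSubdivision
    split_ifs with h1 h2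
    · linarith [minCoord_le h1 y]
    · positivity
    · exact hnn w
  · by_cases hne : e = F
    · subst hne
      -- A point of the subdivided facet lands in the new facet that omits a vertex of least
      -- coordinate, since that coordinate becomes 0.
      obtain ⟨u, hu, hmu⟩ := exists_minCoord_eq e y
      refine ⟨swap e u v, ?_, fun w hw => ?_⟩
      · exact Finset.mem_union_right _ (Finset.mem_image_of_mem _ hu)
      · rw [swap_val hu hvF]
        by_contra hcon
        simp only [Finset.mem_insert, Finset.mem_erase, not_or, not_and] at hcon
        apply hw
        unfold toSubdivision
        by_cases hwe : w ∈ e.1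
        · have : w = u := by by_contra h; exact hcon.2 h hwe
          subst this
          simp [hwe, hmu]
        · simp only [hwe, if_false, hcon.1]
          by_contra h
          exact hwe (hsupp w h)
    · obtain ⟨u, hu, hue⟩ := exists_mem_notMem_of_ne hne
      have hyu : y u = 0 := by by_contra h; exact hue (hsupp u h)
      have hm0 := minCoord_eq_zero hnn hu hyu
      refine ⟨e, Finset.mem_union_left _ (Finset.mem_erase.2 ⟨hne, he⟩), fun w hw => hsupp w ?_⟩
      intro h0
      apply hw
      simp [toSubdivision, hm0, h0]

/-- After subdivision F is no longer a face: each facet omits some vertex of F. This is what makes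
`ofSubdivision` injective on the subdivided complex. -/
theorem minCoord_eq_zero_of_subdivide {d n : ℕ} {S : Finset (Edge d n)} {F : Edge d n}
    {v : Fin n} (hvF : v ∉ F.1) {x : Fin n → ℝ}
    (hx : x ∈ realization (subdivide S F v)) : minCoord F x = 0 := by
  obtain ⟨⟨hnn, -⟩, e, he, hsupp⟩ := hx
  obtain ⟨u, hu, hue⟩ : ∃ u ∈ F.1, u ∉ e.1 := by
    rcases Finset.mem_union.1 he with he | he
    · exact exists_mem_notMem_of_ne (Finset.mem_erase.1 he).1
    · obtain ⟨u, hu, rfl⟩ := Finset.mem_image.1 he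
      refine ⟨u, hu, ?_⟩
      rw [swap_val hu hvF]
      simp only [Finset.mem_insert, Finset.mem_erase, ne_eq, not_true_eq_false, false_and,
        or_false]
      rintro rfl
      exact hvF hu
  exact minCoord_eq_zero hnn hu (by by_contra h; exact hue (hsupp u h))

theorem ofSubdivision_mem {d n : ℕ} {S : Finset (Edge d n)} {F : Edge d n} (hF : F ∈ S)
    {v : Fin n} (hS : ∀ e ∈ S, v ∉ e.1) {x : Fin n → ℝ}
    (hx : x ∈ realization (subdivide S F v)) : ofSubdivision F v x ∈ realization S := by
  have hvF := hS F hF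
  obtain ⟨⟨hnn, hsum⟩, e, he, hsupp⟩ := hx
  refine ⟨⟨fun w => ?_, (sum_ofSubdivision F hvF x).trans hsum⟩, ?_⟩
  · unfold ofSubdivision
    have := hnn v
    have := hnn w
    split_ifs <;> positivity
  · rcases Finset.mem_union.1 he with he | he
    · have heS := (Finset.mem_erase.1 he).2
      have hv0 : x v = 0 := by by_contra h; exact hS e heS (hsupp v h)
      refine ⟨e, heS, fun w hw => hsupp w fun h0 => hw ?_⟩
      simp [ofSubdivision, hv0, h0]
    · obtain ⟨u, hu, rfl⟩ := Finset.mem_image.1 he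
      refine ⟨F, hF, fun w hw => ?_⟩
      by_contra hwF
      apply hw
      simp only [ofSubdivision, hwF, if_false]
      split_ifs with h
      · rfl
      · by_contra h0
        have := hsupp w h0
        rw [swap_val hu hvF] at this
        simp [h, hwF] at this

theorem ofSubdivision_toSubdivision {d n : ℕ} {F : Edge d n} {v : Fin n} (hvF : v ∉ F.1)
    {y : Fin n → ℝ} (hy : y v = 0) : ofSubdivision F v (toSubdivision F v y) = y := by
  have hd : (d : ℝ) + 1 ≠ 0 := by positivity
  funext w
  by_cases hw : w ∈ F.1
  · simp [ofSubdivision, toSubdivision, hw, hvF, hd]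
  · by_cases hwv : w = v
    · subst hwv
      simp [ofSubdivision, hw, hy]
    · simp [ofSubdivision, toSubdivision, hw, hwv]

theorem toSubdivision_ofSubdivision {d n : ℕ} {F : Edge d n} {v : Fin n} (hvF : v ∉ F.1)
    {x : Fin n → ℝ} (hnn : ∀ w, 0 ≤ x w) (hx : minCoord F x = 0) :
    toSubdivision F v (ofSubdivision F v x) = x := by
  have hd : (d : ℝ) + 1 ≠ 0 := by positivity
  have hm : minCoord F (ofSubdivision F v x) = x v / (d + 1) := by
    obtain ⟨u, hu, h⟩ := exists_minCoord_eq F x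
    refine le_antisymm ((minCoord_le hu _).trans ?_) ?_
    · simp [ofSubdivision, hu, ← h, hx]
    · obtain ⟨w, hw, h⟩ := exists_minCoord_eq F (ofSubdivision F v x)
      rw [h]
      simpa [ofSubdivision, hw] using hnn w
  funext w
  by_cases hw : w ∈ F.1
  · simp [toSubdivision, hw, hm]
    simp [ofSubdivision, hw]
  · by_cases hwv : w = v
    · subst hwv
      simp [toSubdivision, hw, hm]
      field_simp
    · simp [ofSubdivision, toSubdivision, hw, hwv]

/-- Stellar subdivision does not change the homeomorphism type. -/
noncomputable def realizationSubdivide {d n : ℕ} {S : Finset (Edge d n)} {F : Edge d n} (hF : F ∈ S)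
    {v : Fin n} (hS : ∀ e ∈ S, v ∉ e.1) :
    realization S ≃ₜ realization (subdivide S F v) where
  toFun y := ⟨toSubdivision F v y, toSubdivision_mem hF hS y.2⟩
  invFun x := ⟨ofSubdivision F v x, ofSubdivision_mem hF hS x.2⟩
  left_inv y := Subtype.ext
    (ofSubdivision_toSubdivision (hS F hF) (apply_eq_zero_of_realization hS y.2))
  right_inv x := Subtype.ext (toSubdivision_ofSubdivision (hS F hF) x.2.1.1
    (minCoord_eq_zero_of_subdivide (hS F hF) x.2))
  continuous_toFun := ((continuous_toSubdivision F v).comp continuous_subtype_val).subtype_mk _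
  continuous_invFun := ((continuous_ofSubdivision F v).comp continuous_subtype_val).subtype_mk _

/-! ### The boundary of the simplex is a sphere, by radial projection from the barycentre. -/

/-- All hyperedges inside a vertex set `A`. -/
def facetsIn (d : ℕ) {n : ℕ} (A : Finset (Fin n)) : Finset (Edge d n) :=
  Finset.univ.filter fun e => e.1 ⊆ A

theorem mem_realization_facetsIn {d n : ℕ} (i : Fin (d + 2) ↪ Fin n) (y : Fin n → ℝ) :
    y ∈ realization (facetsIn d (Finset.univ.map i)) ↔
      (∀ k, 0 ≤ y (i k)) ∧ (∀ v ∉ Set.range i, y v = 0) ∧ ∑ k, y (i k) = 1 ∧ ∃ k, y (i k) = 0 := by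
  have hsum : (∀ v ∉ Set.range i, y v = 0) → ∑ v, y v = ∑ k, y (i k) := by
    intro h
    rw [← Finset.sum_map Finset.univ i y]
    refine (Finset.sum_subset (Finset.subset_univ _) fun v _ hv => h v ?_).symm
    simpa using hv
  constructor
  · rintro ⟨⟨hnn, hs⟩, e, he, hsupp⟩
    have heA : e.1 ⊆ Finset.univ.map i := by simpa [facetsIn] using he
    have h0 : ∀ v ∉ Set.range i, y v = 0 := by
      intro v hv
      by_contra hne
      have := heA (hsupp v hne)
      simp only [Finset.mem_map, Finset.mem_univ, true_and] at this
      exact hv this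
    refine ⟨fun k => hnn _, h0, (hsum h0).symm.trans hs, ?_⟩
    obtain ⟨v, hv, hve⟩ : ∃ v ∈ Finset.univ.map i, v ∉ e.1 := by
      by_contra! hc
      have := Finset.card_le_card hc
      simp [e.2] at this
    obtain ⟨k, -, rfl⟩ := Finset.mem_map.1 hv
    exact ⟨k, by by_contra hne; exact hve (hsupp _ hne)⟩
  · rintro ⟨hnn, h0, hs, k, hk⟩
    refine ⟨⟨fun v => ?_, (hsum h0).trans hs⟩, ⟨(Finset.univ.map i).erase (i k), ?_⟩, ?_, ?_⟩
    · by_cases hv : v ∈ Set.range i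
      · obtain ⟨k, rfl⟩ := hv
        exact hnn k
      · exact (h0 v hv).ge
    · rw [Finset.card_erase_of_mem (by simp)]
      simp
    · simp [facetsIn, Finset.erase_subset]
    · intro v hv
      have hv' : v ∈ Set.range i := by by_contra h; exact hv (h0 v h)
      obtain ⟨l, rfl⟩ := hv'
      simp only [Finset.mem_erase, Finset.mem_map, Finset.mem_univ, true_and]
      refine ⟨?_, l, rfl⟩
      intro h
      rw [h] at hv
      exact hv hk

/-- Completion of a vector of `ℝ^(d+1)` to a vector of `ℝ^(d+2)` with coordinate sum zero. -/
def balance {d : ℕ} (w : Fin (d + 1) → ℝ) : Fin (d + 2) → ℝ := Fin.cons (-∑ k, w k) w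

theorem sum_balance {d : ℕ} (w : Fin (d + 1) → ℝ) : ∑ k, balance w k = 0 := by
  simp [balance, Fin.sum_univ_succ (n := d + 1)]

theorem continuous_balance {d : ℕ} : Continuous (balance (d := d)) := by
  refine continuous_pi fun k => ?_
  refine Fin.cases ?_ (fun k => ?_) k
  · simp only [balance, Fin.cons_zero]; fun_prop
  · simp only [balance, Fin.cons_succ]; fun_prop

theorem balance_smul {d : ℕ} (c : ℝ) (w : Fin (d + 1) → ℝ) :
    balance (c • w) = c • balance w := by
  funext k
  refine Fin.cases ?_ (fun k => ?_) k
  · simp [balance, Finset.mul_sum]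
  · simp [balance]

theorem balance_tail {d : ℕ} {z : Fin (d + 2) → ℝ} (hz : ∑ k, z k = 0) :
    balance (fun k => z k.succ) = z := by
  funext k
  rw [Fin.sum_univ_succ] at hz
  refine Fin.cases ?_ (fun k => ?_) k
  · simp only [balance, Fin.cons_zero]; linarith
  · simp [balance]

/-- Minus the least coordinate of a vector. -/
def depth {d : ℕ} (z : Fin (d + 2) → ℝ) : ℝ :=
  -Finset.univ.inf' Finset.univ_nonempty z

theorem neg_depth_le {d : ℕ} (z : Fin (d + 2) → ℝ) (k : Fin (d + 2)) : -depth z ≤ z k := by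
  rw [depth, neg_neg]; exact Finset.inf'_le _ (Finset.mem_univ k)

theorem exists_eq_neg_depth {d : ℕ} (z : Fin (d + 2) → ℝ) : ∃ k, z k = -depth z := by
  obtain ⟨k, -, h⟩ := Finset.exists_mem_eq_inf' Finset.univ_nonempty z
  exact ⟨k, by rw [depth, neg_neg, h]⟩

theorem continuous_depth {d : ℕ} : Continuous (depth (d := d)) :=
  (Continuous.finset_inf'_apply _ fun i _ => continuous_apply i).neg

theorem depth_eq {d : ℕ} {z : Fin (d + 2) → ℝ} {a : ℝ} (h : ∀ k, -a ≤ z k) {k : Fin (d + 2)}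
    (hk : z k = -a) : depth z = a := by
  obtain ⟨l, hl⟩ := exists_eq_neg_depth z
  have := neg_depth_le z k
  have := h l
  linarith

/-- A nonzero vector with coordinate sum zero has a negative coordinate. -/
theorem depth_pos {d : ℕ} {w : Fin (d + 1) → ℝ} (hw : w ≠ 0) : 0 < depth (balance w) := by
  by_contra! hc
  have hnn : ∀ k, 0 ≤ balance w k := fun k => by linarith [neg_depth_le (balance w) k]
  have h0 := (Finset.sum_eq_zero_iff_of_nonneg fun k _ => hnn k).1 (sum_balance w)
  exact hw (funext fun k => by simpa [balance] using h0 k.succ (Finset.mem_univ _))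

/-- The point of the boundary of the simplex in the direction of `w`. -/
noncomputable def boundaryPoint {d : ℕ} (w : Fin (d + 1) → ℝ) (k : Fin (d + 2)) : ℝ :=
  (balance w k / depth (balance w) + 1) / (d + 2)

theorem exists_boundaryPoint_eq_zero {d : ℕ} {w : Fin (d + 1) → ℝ} (hw : w ≠ 0) :
    ∃ k, boundaryPoint w k = 0 := by
  obtain ⟨k, hk⟩ := exists_eq_neg_depth (balance w)
  refine ⟨k, ?_⟩
  have := (depth_pos hw).ne'
  simp [boundaryPoint, hk, this]

theorem boundaryPoint_nonneg {d : ℕ} {w : Fin (d + 1) → ℝ} (hw : w ≠ 0) (k : Fin (d + 2)) :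
    0 ≤ boundaryPoint w k := by
  have h := depth_pos hw
  have : -1 ≤ balance w k / depth (balance w) := by
    rw [le_div_iff₀ h]; linarith [neg_depth_le (balance w) k]
  unfold boundaryPoint
  have : (0 : ℝ) < d + 2 := by positivity
  apply div_nonneg _ this.le
  linarith

theorem sum_boundaryPoint {d : ℕ} (w : Fin (d + 1) → ℝ) : ∑ k, boundaryPoint w k = 1 := by
  have : (d : ℝ) + 2 ≠ 0 := by positivity
  simp_rw [boundaryPoint, ← Finset.sum_div, Finset.sum_add_distrib, ← Finset.sum_div, sum_balance]
  simp [this]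

/-- Subtracting the barycentre from y leaves a vector of sum zero whose least coordinate is exactly
-1/(d+2), because a coordinate of y vanishes. Thus `depth` reads off the scale c/(d+2), and the
whole ray through y is sent back to y. -/
theorem boundaryPoint_of_mem {d : ℕ} {y : Fin (d + 2) → ℝ} (hnn : ∀ k, 0 ≤ y k)
    (hs : ∑ k, y k = 1) {k : Fin (d + 2)} (hk : y k = 0) {c : ℝ} (hc : 0 < c) :
    boundaryPoint (c • fun k : Fin (d + 1) => y k.succ - 1 / (d + 2)) = y := by
  have hd : (0 : ℝ) < d + 2 := by positivity
  have hb : balance (c • fun k : Fin (d + 1) => y k.succ - 1 / (d + 2 : ℝ)) =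
      c • fun k => y k - 1 / (d + 2 : ℝ) := by
    rw [balance_smul, balance_tail (z := fun k => y k - 1 / (d + 2 : ℝ))]
    rw [Finset.sum_sub_distrib, hs]
    simp [hd.ne']
  have hdep : depth (c • fun k => y k - 1 / (d + 2 : ℝ)) = c / (d + 2) := by
    refine depth_eq (k := k) (fun l => ?_) ?_
    · have := mul_nonneg hc.le (hnn l)
      simp only [Pi.smul_apply, smul_eq_mul, mul_sub]
      have : c * (1 / (d + 2 : ℝ)) = c / (d + 2) := by ring
      linarith
    · simp [hk]; ring
  funext l
  rw [boundaryPoint, hb, hdep]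
  simp only [Pi.smul_apply, smul_eq_mul]
  field_simp
  ring

/-- Coordinates of a point relative to the barycentre of the simplex, the first one dropped. -/
noncomputable def direction {d n : ℕ} (i : Fin (d + 2) ↪ Fin n) (y : Fin n → ℝ) :
    EuclideanSpace ℝ (Fin (d + 1)) :=
  WithLp.toLp 2 fun k : Fin (d + 1) => y (i k.succ) - 1 / (d + 2 : ℝ)

theorem continuous_direction {d n : ℕ} (i : Fin (d + 2) ↪ Fin n) : Continuous (direction i) := by
  unfold direction
  fun_prop

theorem direction_ne_zero {d n : ℕ} {i : Fin (d + 2) ↪ Fin n} {y : Fin n → ℝ}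
    (hy : y ∈ realization (facetsIn d (Finset.univ.map i))) : direction i y ≠ 0 := by
  obtain ⟨-, -, hs, k, hk⟩ := (mem_realization_facetsIn i y).1 hy
  intro h
  have hd : (0 : ℝ) < d + 2 := by positivity
  have h1 : ∀ k : Fin (d + 1), y (i k.succ) = 1 / (d + 2 : ℝ) := fun k => by
    have := congrArg (fun z : EuclideanSpace ℝ (Fin (d + 1)) => z k) h
    simp only [direction, PiLp.zero_apply] at this
    linarith
  have h0 : y (i 0) = 1 / (d + 2 : ℝ) := by
    rw [Fin.sum_univ_succ, Finset.sum_congr rfl fun k _ => h1 k] at hs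
    simp at hs
    field_simp at hs ⊢
    linarith
  have : y (i k) = 1 / (d + 2 : ℝ) := Fin.cases h0 h1 k
  rw [hk] at this
  exact absurd this.symm (by positivity)

theorem ofLp_ne_zero_of_mem_sphere {d : ℕ} {w : EuclideanSpace ℝ (Fin (d + 1))}
    (hw : w ∈ Metric.sphere (0 : EuclideanSpace ℝ (Fin (d + 1))) 1) : WithLp.ofLp w ≠ 0 := by
  intro h
  have : w = 0 := by simpa using h
  simp [this] at hw

theorem continuous_extend {d n : ℕ} (i : Fin (d + 2) ↪ Fin n) :
    Continuous fun z : Fin (d + 2) → ℝ => (Function.extend i z 0 : Fin n → ℝ) := by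
  refine continuous_pi fun v => ?_
  by_cases hv : ∃ k, i k = v
  · obtain ⟨k, rfl⟩ := hv
    simp only [i.injective.extend_apply]
    fun_prop
  · simp only [Function.extend_apply' _ _ _ hv]
    fun_prop

theorem extend_boundaryPoint_mem {d n : ℕ} (i : Fin (d + 2) ↪ Fin n) {w : Fin (d + 1) → ℝ}
    (hw : w ≠ 0) : Function.extend i (boundaryPoint w) 0 ∈
      realization (facetsIn d (Finset.univ.map i)) := by
  rw [mem_realization_facetsIn]
  simp only [i.injective.extend_apply]
  exact ⟨boundaryPoint_nonneg hw, fun v hv => Function.extend_apply' _ _ _ hv,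
    sum_boundaryPoint w, exists_boundaryPoint_eq_zero hw⟩

theorem direction_extend_boundaryPoint {d n : ℕ} (i : Fin (d + 2) ↪ Fin n)
    (w : EuclideanSpace ℝ (Fin (d + 1))) :
    direction i (Function.extend i (boundaryPoint (WithLp.ofLp w)) 0) =
      (depth (balance (WithLp.ofLp w)) * (d + 2))⁻¹ • w := by
  ext k
  have hd : (d : ℝ) + 2 ≠ 0 := by positivity
  simp only [direction, i.injective.extend_apply, boundaryPoint, balance, Fin.cons_succ,
    PiLp.smul_apply, smul_eq_mul]
  field_simp
  ring

/-- The boundary of the `(d+1)`-simplex is homeomorphic to the `d`-sphere. -/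
noncomputable def realizationFacetsIn {d n : ℕ} (i : Fin (d + 2) ↪ Fin n) :
    realization (facetsIn d (Finset.univ.map i)) ≃ₜ
      Metric.sphere (0 : EuclideanSpace ℝ (Fin (d + 1))) 1 where
  toFun y := ⟨‖direction i y.1‖⁻¹ • direction i y.1, by
    have := direction_ne_zero y.2
    simp [norm_smul, this]⟩
  invFun w := ⟨Function.extend i (boundaryPoint (WithLp.ofLp w.1)) 0,
    extend_boundaryPoint_mem i (ofLp_ne_zero_of_mem_sphere w.2)⟩
  left_inv y := by
    obtain ⟨hnn, h0, hs, k, hk⟩ := (mem_realization_facetsIn i y.1).1 y.2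
    have hc : 0 < ‖direction i y.1‖⁻¹ := inv_pos.2 (norm_pos_iff.2 (direction_ne_zero y.2))
    have := boundaryPoint_of_mem (y := fun k => y.1 (i k)) hnn hs hk hc
    apply Subtype.ext
    funext v
    by_cases hv : ∃ k, i k = v
    · obtain ⟨l, rfl⟩ := hv
      simp only [i.injective.extend_apply]
      exact congrFun this l
    · simp only [Function.extend_apply' _ _ _ hv]
      exact (h0 v hv).symm
  right_inv w := by
    apply Subtype.ext
    have hw : ‖w.1‖ = 1 := by simp
    have hpos : 0 < depth (balance (WithLp.ofLp w.1)) * (d + 2) :=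
      mul_pos (depth_pos (ofLp_ne_zero_of_mem_sphere w.2)) (by positivity)
    simp only [direction_extend_boundaryPoint, norm_smul, hw, norm_inv, Real.norm_eq_abs,
      abs_of_pos hpos, smul_smul, mul_one, inv_inv, mul_inv_cancel₀ hpos.ne', one_smul]
  continuous_toFun := by
    have h : Continuous fun y : realization (facetsIn d (Finset.univ.map i)) =>
      direction i y.1 := (continuous_direction i).comp continuous_subtype_val
    exact ((h.norm.inv₀ fun y => norm_ne_zero_iff.2 (direction_ne_zero y.2)).smul h).subtype_mk _
  continuous_invFun := by
    refine Continuous.subtype_mk ((continuous_extend i).comp (continuous_pi fun k => ?_)) _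
    have hb : Continuous fun w : Metric.sphere (0 : EuclideanSpace ℝ (Fin (d + 1))) 1 =>
        balance (WithLp.ofLp w.1) := by
      have := continuous_balance (d := d)
      fun_prop
    have hk := (continuous_apply k).comp hb
    have hdep := continuous_depth.comp hb
    exact ((hk.div hdep fun w => (depth_pos (ofLp_ne_zero_of_mem_sphere w.2)).ne').add
      continuous_const).div_const _

/-! ### Greedy insertion of vertices. -/

/-- `S` is a `d`-sphere with vertex set `U` and with a distinguished facet `F`. -/
structure IsPartialSphere {d n : ℕ} (S : Finset (Edge d n)) (F : Edge d n)
    (U : Finset (Fin n)) : Prop where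
  homeo : Nonempty (realization S ≃ₜ Metric.sphere (0 : EuclideanSpace ℝ (Fin (d + 1))) 1)
  mem : F ∈ S
  cover : ∀ v, v ∈ U ↔ ∃ e ∈ S, v ∈ e.1

theorem IsPartialSphere.subset {d n : ℕ} {S : Finset (Edge d n)} {F : Edge d n}
    {U : Finset (Fin n)} (h : IsPartialSphere S F U) : F.1 ⊆ U :=
  fun v hv => (h.cover v).2 ⟨F, h.mem, hv⟩

/-- The vertex of `F` that is dropped when `F` is replaced by the next open facet. -/
def pivot {d n : ℕ} (F : Edge d n) : Fin n := F.1.min' (edge_nonempty F)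

theorem pivot_mem {d n : ℕ} (F : Edge d n) : pivot F ∈ F.1 := Finset.min'_mem _ _

/-- The facet that stays open when `F` is subdivided at `v`. -/
def nextFacet {d n : ℕ} (F : Edge d n) (v : Fin n) : Edge d n := swap F (pivot F) v

/-- The price of the facets that become final when `F` is subdivided at `v`. -/
def stepCost {d n : ℕ} (W : Edge d n → ℝ) (F : Edge d n) (v : Fin n) : ℝ :=
  ∑ u ∈ F.1.erase (pivot F), W (swap F u v)

/-- The exponential of the cheapest way to insert `r` vertices of `R` one by one, always
subdividing the open facet, when the last open facet is not paid for. -/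
noncomputable def insertionValue {d n : ℕ} :
    ℕ → Edge d n → Finset (Fin n) → (Edge d n → ℝ) → ENNReal
  | 0, _, _, _ => 1
  | r + 1, F, R, W => ⨅ v ∈ R, ENNReal.ofReal (Real.exp (stepCost W F v)) *
      insertionValue r (nextFacet F v) (R.erase v) W

theorem IsPartialSphere.subdivide {d n : ℕ} {S : Finset (Edge d n)} {F : Edge d n}
    {U : Finset (Fin n)} (h : IsPartialSphere S F U) {v : Fin n} (hv : v ∉ U) (hd : 1 ≤ d) :
    IsPartialSphere (subdivide S F v) (nextFacet F v) (insert v U) := by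
  have hS : ∀ e ∈ S, v ∉ e.1 := fun e he hve => hv ((h.cover v).2 ⟨e, he, hve⟩)
  have hvF := hS F h.mem
  refine ⟨⟨(realizationSubdivide h.mem hS).symm.trans h.homeo.some⟩,
    Finset.mem_union_right _ (Finset.mem_image_of_mem _ (pivot_mem F)), fun w => ?_⟩
  constructor
  · intro hw
    rcases Finset.mem_insert.1 hw with rfl | hw
    · refine ⟨nextFacet F w,
        Finset.mem_union_right _ (Finset.mem_image_of_mem _ (pivot_mem F)), ?_⟩
      simp [nextFacet, swap_val (pivot_mem F) hvF]
    · obtain ⟨e, he, hwe⟩ := (h.cover w).1 hw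
      by_cases heF : e = F
      · subst heF
        -- F has d + 1 ≥ 2 vertices, so one other than w can be swapped out, and w stays covered.
        obtain ⟨u, hu, huw⟩ := Finset.exists_mem_ne (s := e.1) (by rw [e.2]; omega) w
        exact ⟨swap e u v, Finset.mem_union_right _ (Finset.mem_image_of_mem _ hu),
          by simp [swap_val hu hvF, hwe, huw.symm]⟩
      · exact ⟨e, Finset.mem_union_left _ (Finset.mem_erase.2 ⟨heF, he⟩), hwe⟩
  · rintro ⟨e, he, hwe⟩
    rcases Finset.mem_union.1 he with he | he
    · exact Finset.mem_insert_of_mem ((h.cover w).2 ⟨e, (Finset.mem_erase.1 he).2, hwe⟩)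
    · obtain ⟨u, hu, rfl⟩ := Finset.mem_image.1 he
      rw [swap_val hu hvF] at hwe
      rcases Finset.mem_insert.1 hwe with rfl | hwe
      · simp
      · exact Finset.mem_insert_of_mem (h.subset (Finset.mem_erase.1 hwe).2)

/-- The open facet is kept off the bill: removing F changes nothing in the paid total, and of the
new facets only the next open one is left out. Summed over the steps, this telescopes. -/
theorem cost_subdivide {d n : ℕ} {S : Finset (Edge d n)} {F : Edge d n}
    {U : Finset (Fin n)} (h : IsPartialSphere S F U) {v : Fin n} (hv : v ∉ U)
    (W : Edge d n → ℝ) : cost W (subdivide S F v) - W (nextFacet F v) =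
      cost W S - W F + stepCost W F v := by
  have hS : ∀ e ∈ S, v ∉ e.1 := fun e he hve => hv ((h.cover v).2 ⟨e, he, hve⟩)
  have hvF := hS F h.mem
  have hdisj : Disjoint (S.erase F) (F.1.image fun u => swap F u v) := by
    rw [Finset.disjoint_left]
    intro e he he'
    obtain ⟨u, hu, rfl⟩ := Finset.mem_image.1 he'
    exact hS _ (Finset.mem_erase.1 he).2 (by simp [swap_val hu hvF])
  rw [cost, subdivide, Finset.sum_union hdisj, Finset.sum_image (swap_injOn hvF), cost,
    ← Finset.add_sum_erase S _ h.mem, stepCost, ← Finset.add_sum_erase F.1 _ (pivot_mem F),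
    nextFacet]
  ring

/-- At each stage the set of remaining vertices is finite and nonempty, so the infimum defining
`insertionValue` is attained; following the minimisers builds an actual sphere. -/
theorem exists_sphere_cost_le {d n : ℕ} (hd : 1 ≤ d) (W : Edge d n → ℝ) (r : ℕ) :
    ∀ {S : Finset (Edge d n)} {F : Edge d n} {U : Finset (Fin n)}, IsPartialSphere S F U →
      Uᶜ.card = r → ∃ S' ∈ spheres d n, ∃ F' ∈ S',
        ENNReal.ofReal (Real.exp (cost W S' - W F')) ≤
          ENNReal.ofReal (Real.exp (cost W S - W F)) * insertionValue r F Uᶜ W := by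
  induction r with
  | zero =>
    intro S F U h hU
    have hU : U = Finset.univ := by simpa using hU
    refine ⟨S, ⟨fun v => (h.cover v).1 (by simp [hU]), h.homeo⟩, F, h.mem, ?_⟩
    simp [insertionValue]
  | succ r ih =>
    intro S F U h hU
    have hne : Uᶜ.Nonempty := Finset.card_pos.1 (by omega)
    obtain ⟨v, hv, hmin⟩ := Finset.exists_mem_eq_inf Uᶜ hne fun v =>
      ENNReal.ofReal (Real.exp (stepCost W F v)) * insertionValue r (nextFacet F v) (Uᶜ.erase v) W
    have hvU : v ∉ U := by simpa using hv
    have hc : (insert v U)ᶜ = Uᶜ.erase v := by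
      ext w; simp
    obtain ⟨S', hS', F', hF', hle⟩ := ih (h.subdivide hvU hd)
      (by rw [hc, Finset.card_erase_of_mem hv, hU]; rfl)
    refine ⟨S', hS', F', hF', hle.trans (le_of_eq ?_)⟩
    rw [insertionValue, ← Finset.inf_eq_iInf, hmin, cost_subdivide h hvU, Real.exp_add,
      ENNReal.ofReal_mul (Real.exp_pos _).le, mul_assoc, hc]

theorem stepCost_le {d n : ℕ} {W : Edge d n → ℝ} {b : ℝ} (hW : ∀ e, W e ≤ b) (F : Edge d n)
    (v : Fin n) : stepCost W F v ≤ d * b := by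
  refine (Finset.sum_le_card_nsmul _ _ b fun u _ => hW _).trans_eq ?_
  rw [Finset.card_erase_of_mem (pivot_mem F), F.2]
  simp

/-- Any insertion order costs at most d per vertex; this is the worst case behind `minCost_le_mul`.
-/
theorem insertionValue_le {d n : ℕ} {W : Edge d n → ℝ} (hW : ∀ e, W e ≤ 1) (r : ℕ) :
    ∀ (F : Edge d n) (R : Finset (Fin n)), R.card = r →
      insertionValue r F R W ≤ ENNReal.ofReal (Real.exp (d * r)) := by
  induction r with
  | zero => intro F R _; simp [insertionValue]
  | succ r ih =>
    intro F R hR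
    obtain ⟨v, hv⟩ : R.Nonempty := Finset.card_pos.1 (by omega)
    refine (iInf₂_le v hv).trans ?_
    have := ih (nextFacet F v) (R.erase v) (by rw [Finset.card_erase_of_mem hv, hR]; rfl)
    refine (mul_le_mul' (ENNReal.ofReal_le_ofReal
      (Real.exp_le_exp.2 (stepCost_le hW F v))) this).trans_eq ?_
    rw [← ENNReal.ofReal_mul (Real.exp_pos _).le, ← Real.exp_add]
    congr 2
    push_cast
    ring

/-- The source of independence: once a step is done, the pivot of F is out of reach, so no later
facet contains it, whereas all facets bought in this step do. -/
theorem nextFacet_union_subset {d n : ℕ} {F : Edge d n} {R : Finset (Fin n)}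
    (hR : Disjoint F.1 R) {v : Fin n} (hv : v ∈ R) :
    (nextFacet F v).1 ∪ R.erase v ⊆ (F.1 ∪ R).erase (pivot F) := by
  have hvF : v ∉ F.1 := Finset.disjoint_right.1 hR hv
  have hp : ∀ w ∈ R, w ≠ pivot F := fun w hw h => Finset.disjoint_right.1 hR hw (h ▸ pivot_mem F)
  intro w hw
  simp only [nextFacet, swap_val (pivot_mem F) hvF, Finset.mem_union, Finset.mem_insert,
    Finset.mem_erase] at hw ⊢
  rcases hw with (rfl | hw) | hw
  · exact ⟨hp w hv, Or.inr hv⟩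
  · exact ⟨hw.1, Or.inl hw.2⟩
  · exact ⟨hp w hw.2, Or.inr hw.2⟩

theorem nextFacet_disjoint {d n : ℕ} {F : Edge d n} {R : Finset (Fin n)}
    (hR : Disjoint F.1 R) {v : Fin n} (hv : v ∈ R) :
    Disjoint (nextFacet F v).1 (R.erase v) := by
  have hvF : v ∉ F.1 := Finset.disjoint_right.1 hR hv
  rw [Finset.disjoint_left] at hR ⊢
  intro w hw hw'
  rw [nextFacet, swap_val (pivot_mem F) hvF, Finset.mem_insert] at hw
  rw [Finset.mem_erase] at hw'
  rcases hw with rfl | hw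
  · exact hw'.1 rfl
  · exact hR (Finset.mem_erase.1 hw).2 hw'.2

/-- Only hyperedges inside F ∪ R are ever consulted. Applied after one step, together with
`nextFacet_union_subset`, it shows that the continuation ignores every hyperedge through the old
pivot. -/
theorem insertionValue_congr {d n : ℕ} {W W' : Edge d n → ℝ} (r : ℕ) :
    ∀ {F : Edge d n} {R : Finset (Fin n)}, Disjoint F.1 R →
      (∀ e : Edge d n, e.1 ⊆ F.1 ∪ R → W e = W' e) →
      insertionValue r F R W = insertionValue r F R W' := by
  induction r with
  | zero => intros; rfl
  | succ r ih =>
    intro F R hR hW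
    simp only [insertionValue]
    refine iInf_congr fun v => iInf_congr fun hv => ?_
    have hvF : v ∉ F.1 := Finset.disjoint_right.1 hR hv
    rw [ih (nextFacet_disjoint hR hv) fun e he => hW e
      (he.trans ((nextFacet_union_subset hR hv).trans (Finset.erase_subset _ _)))]
    congr 3
    refine Finset.sum_congr rfl fun u hu => hW _ ?_
    rw [swap_val (Finset.mem_erase.1 hu).2 hvF]
    intro w hw
    rcases Finset.mem_insert.1 hw with rfl | hw
    · exact Finset.mem_union_right _ hv
    · exact Finset.mem_union_left _ (Finset.mem_erase.1 hw).2

theorem measurable_stepCost {d n : ℕ} (F : Edge d n) (v : Fin n) :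
    Measurable fun W : Edge d n → ℝ => stepCost W F v :=
  Finset.measurable_sum _ fun _ _ => measurable_pi_apply _

theorem measurable_insertionValue {d n : ℕ} (r : ℕ) :
    ∀ (F : Edge d n) (R : Finset (Fin n)), Measurable (insertionValue r F R) := by
  induction r with
  | zero => intro F R; exact measurable_const
  | succ r ih =>
    intro F R
    refine Measurable.iInf fun v => Measurable.iInf fun _ => ?_
    exact ((Real.measurable_exp.comp (measurable_stepCost F v)).ennreal_ofReal).mul (ih _ _)

/-- The boundary of a simplex is a partial sphere to start from. -/
theorem exists_isPartialSphere {d n : ℕ} (hn : d + 2 ≤ n) :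
    ∃ (S : Finset (Edge d n)) (F : Edge d n) (U : Finset (Fin n)),
      IsPartialSphere S F U ∧ S.card ≤ d + 2 ∧ U.card = d + 2 := by
  let i : Fin (d + 2) ↪ Fin n := Fin.castLEEmb hn
  let A : Finset (Fin n) := Finset.univ.map i
  have hA : A.card = d + 2 := by simp [A]
  have hmem : ∀ v ∈ A, (A.erase v).card = d + 1 := fun v hv => by
    rw [Finset.card_erase_of_mem hv, hA]; rfl
  have hcard : (facetsIn d A).card ≤ d + 2 := by
    have h : (facetsIn d A).map (Function.Embedding.subtype _) ⊆ A.powersetCard (d + 1) := by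
      intro s hs
      obtain ⟨e, he, rfl⟩ := Finset.mem_map.1 hs
      exact Finset.mem_powersetCard.2 ⟨by simpa [facetsIn] using he, e.2⟩
    have := Finset.card_le_card h
    rw [Finset.card_map, Finset.card_powersetCard, hA] at this
    exact this.trans_eq (by rw [Nat.choose_symm_of_eq_add (b := 1) rfl]; simp)
  have h0 : i 0 ∈ A := by simp [A]
  have hfac : ∀ v (hv : v ∈ A), (⟨A.erase v, hmem v hv⟩ : Edge d n) ∈ facetsIn d A := fun v hv => by
    simp [facetsIn, Finset.erase_subset]
  refine ⟨facetsIn d A, ⟨A.erase (i 0), hmem _ h0⟩, A, ⟨⟨realizationFacetsIn i⟩, hfac _ h0, ?_⟩,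
    hcard, hA⟩
  intro v
  constructor
  · intro hv
    obtain ⟨w, hw, hne⟩ := Finset.exists_mem_ne (s := A) (by omega) v
    exact ⟨⟨A.erase w, hmem w hw⟩, hfac w hw, Finset.mem_erase.2 ⟨hne.symm, hv⟩⟩
  · rintro ⟨e, he, hv⟩
    have : e.1 ⊆ A := by simpa [facetsIn] using he
    exact this hv

theorem spheres_nonempty {d n : ℕ} (hd : 1 ≤ d) (hn : d + 2 ≤ n) : (spheres d n).Nonempty := by
  obtain ⟨S, F, U, h, -⟩ := exists_isPartialSphere hn
  obtain ⟨S', hS', -⟩ := exists_sphere_cost_le hd 0 _ h rfl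
  exact ⟨S', hS'⟩

theorem minCost_le {d n : ℕ} (W : Edge d n → ℝ) {S : Finset (Edge d n)} (hS : S ∈ spheres d n) :
    minCost W ≤ cost W S :=
  csInf_le ((Set.toFinite _).bddBelow) (Set.mem_image_of_mem _ hS)

theorem exists_minCost_eq {d n : ℕ} (hd : 1 ≤ d) (hn : d + 2 ≤ n) (W : Edge d n → ℝ) :
    ∃ S ∈ spheres d n, minCost W = cost W S := by
  obtain ⟨S, hS, h⟩ := ((spheres_nonempty hd hn).image (cost W)).csInf_mem (Set.toFinite _)
  exact ⟨S, hS, h.symm⟩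

/-- The greedy construction bounds the minimum cost. -/
theorem exists_exp_minCost_le {d n : ℕ} (hd : 1 ≤ d) (hn : d + 2 ≤ n) :
    ∃ (F : Edge d n) (R : Finset (Fin n)), Disjoint F.1 R ∧ R.card = n - (d + 2) ∧
      ∀ W : Edge d n → ℝ, (∀ e, 0 ≤ W e) → (∀ e, W e ≤ 1) →
        ENNReal.ofReal (Real.exp (minCost W - (d + 3))) ≤ insertionValue (n - (d + 2)) F R W := by
  obtain ⟨S, F, U, h, hS, hU⟩ := exists_isPartialSphere hn
  have hR : Uᶜ.card = n - (d + 2) := by rw [Finset.card_compl, hU, Fintype.card_fin]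
  refine ⟨F, Uᶜ, disjoint_compl_right.mono_left h.subset, hR, fun W hW0 hW => ?_⟩
  obtain ⟨S', hS', F', hF', hle⟩ := exists_sphere_cost_le hd W _ h hR
  -- The d + 3 is made of at most d + 2 for the initial simplex boundary and at most 1 for the last
  -- open facet, which must be paid for in the end.
  have h1 : minCost W - (d + 3) ≤ (cost W S' - W F') + (-(d + 2)) := by
    linarith [minCost_le W hS', hW F']
  have h2 : cost W S - W F ≤ d + 2 := by
    have : cost W S ≤ S.card • (1 : ℝ) := Finset.sum_le_card_nsmul _ _ _ fun e _ => hW e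
    have h3 : (S.card : ℝ) ≤ d + 2 := by exact_mod_cast hS
    simp only [nsmul_eq_mul, mul_one] at this
    linarith [hW0 F]
  calc ENNReal.ofReal (Real.exp (minCost W - (d + 3)))
      ≤ ENNReal.ofReal (Real.exp (cost W S' - W F')) *
          ENNReal.ofReal (Real.exp (-(d + 2))) := by
        rw [← ENNReal.ofReal_mul (Real.exp_pos _).le, ← Real.exp_add]
        exact ENNReal.ofReal_le_ofReal (Real.exp_le_exp.2 h1)
    _ ≤ (ENNReal.ofReal (Real.exp (d + 2)) * insertionValue (n - (d + 2)) F Uᶜ W) *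
          ENNReal.ofReal (Real.exp (-(d + 2))) := by
        gcongr
        refine hle.trans ?_
        gcongr
    _ = insertionValue (n - (d + 2)) F Uᶜ W := by
        rw [mul_right_comm, ← ENNReal.ofReal_mul (Real.exp_pos _).le, ← Real.exp_add]
        simp

/-- The greedy sphere costs at most d(n - d - 2) + d + 3, which is at most d n because d ≥ 2. -/
theorem minCost_le_mul {d n : ℕ} (hd : 2 ≤ d) (hn : d + 2 ≤ n) {W : Edge d n → ℝ}
    (hW0 : ∀ e, 0 ≤ W e) (hW : ∀ e, W e ≤ 1) : minCost W ≤ d * n := by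
  obtain ⟨F, R, -, hR, h⟩ := exists_exp_minCost_le (d := d) (n := n) (by omega) hn
  have h1 := (h W hW0 hW).trans (insertionValue_le hW _ F R hR)
  rw [ENNReal.ofReal_le_ofReal_iff (Real.exp_pos _).le, Real.exp_le_exp,
    Nat.cast_sub hn] at h1
  have : (2 : ℝ) ≤ d := by exact_mod_cast hd
  push_cast at h1
  nlinarith

theorem minCost_nonneg {d n : ℕ} {W : Edge d n → ℝ} (hW : ∀ e, 0 ≤ W e) : 0 ≤ minCost W := by
  refine Real.sInf_nonneg ?_
  rintro _ ⟨S, -, rfl⟩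
  exact Finset.sum_nonneg fun e _ => hW e

/-! ### Uniform costs and a transport inequality in the coordinates √x. -/

instance instIsProbabilityMeasureUnif :
    IsProbabilityMeasure (volume.restrict (Set.Icc (0 : ℝ) 1)) := ⟨by simp⟩

instance instIsProbabilityMeasureCostLaw (d n : ℕ) : IsProbabilityMeasure (costLaw d n) := by
  unfold costLaw; infer_instance

theorem ae_costLaw_mem (d n : ℕ) : ∀ᵐ W ∂costLaw d n, ∀ e, W e ∈ Set.Icc (0 : ℝ) 1 := by
  rw [ae_all_iff]
  intro e
  exact (measurePreserving_eval (fun _ : Edge d n => volume.restrict (Set.Icc (0 : ℝ) 1)) e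
    ).quasiMeasurePreserving.ae (ae_restrict_mem measurableSet_Icc)

/-- Length of a set of level points in `[0,1]` in terms of a lower bound of its points. -/
theorem volume_le_of_forall_ge {P : Set ℝ} {c : ℝ} (hP : P ⊆ Set.Icc 0 1) (hc : ∀ u ∈ P, c ≤ u) :
    volume P ≤ ENNReal.ofReal (1 - c) := by
  calc volume P ≤ volume (Set.Icc c 1) := measure_mono fun u hu => ⟨hc u hu, (hP hu).2⟩
    _ = ENNReal.ofReal (1 - c) := Real.volume_Icc

/-- A one-dimensional Brunn–Minkowski bound in its easiest form: each set lies between its infimum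
and 1, and the two infima add up to at least 2κ. -/
theorem volume_add_volume_le {P Q : Set ℝ} {κ : ℝ} (hP : P ⊆ Set.Icc 0 1) (hQ : Q ⊆ Set.Icc 0 1)
    (hPn : P.Nonempty) (hQn : Q.Nonempty) (h : ∀ u ∈ P, ∀ v ∈ Q, 2 * κ ≤ u + v) :
    volume P + volume Q ≤ ENNReal.ofReal (2 - 2 * κ) := by
  have hbP : BddBelow P := ⟨0, fun u hu => (hP hu).1⟩
  have hbQ : BddBelow Q := ⟨0, fun u hu => (hQ hu).1⟩
  have h1 : 2 * κ ≤ sInf P + sInf Q := by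
    have : ∀ v ∈ Q, 2 * κ - v ≤ sInf P := fun v hv =>
      le_csInf hPn fun u hu => by linarith [h u hu v hv]
    have : 2 * κ - sInf P ≤ sInf Q := le_csInf hQn fun v hv => by linarith [this v hv]
    linarith
  have hP1 : sInf P ≤ 1 := by
    obtain ⟨u, hu⟩ := hPn
    exact (csInf_le hbP hu).trans (hP hu).2
  have hQ1 : sInf Q ≤ 1 := by
    obtain ⟨u, hu⟩ := hQn
    exact (csInf_le hbQ hu).trans (hQ hu).2
  calc volume P + volume Q ≤ ENNReal.ofReal (1 - sInf P) + ENNReal.ofReal (1 - sInf Q) :=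
        add_le_add (volume_le_of_forall_ge hP fun u hu => csInf_le hbP hu)
          (volume_le_of_forall_ge hQ fun u hu => csInf_le hbQ hu)
    _ = ENNReal.ofReal ((1 - sInf P) + (1 - sInf Q)) :=
        (ENNReal.ofReal_add (by linarith) (by linarith)).symm
    _ ≤ ENNReal.ofReal (2 - 2 * κ) := ENNReal.ofReal_le_ofReal (by linarith)

/-- Layer-cake form of the one-dimensional Prékopa–Leindler inequality for functions with
supremum `1`. -/
theorem lintegral_add_lintegral_le {p q : ℝ → ℝ} (hp : Measurable p) (hq : Measurable q)
    (hp0 : ∀ u ∈ Set.Icc (0 : ℝ) 1, 0 ≤ p u) (hq0 : ∀ u ∈ Set.Icc (0 : ℝ) 1, 0 ≤ q u)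
    (hp1 : IsLUB (p '' Set.Icc 0 1) 1) (hq1 : IsLUB (q '' Set.Icc 0 1) 1)
    {κ : ℝ} (hκ0 : 0 ≤ κ) (hκ1 : κ ≤ 1)
    (h : ∀ u ∈ Set.Icc (0 : ℝ) 1, ∀ v ∈ Set.Icc (0 : ℝ) 1,
      κ ^ 2 * (p u * q v) ≤ ((u + v) / 2) ^ 2) :
    (∫⁻ u in Set.Icc (0 : ℝ) 1, ENNReal.ofReal (p u)) +
      (∫⁻ u in Set.Icc (0 : ℝ) 1, ENNReal.ofReal (q u)) ≤ ENNReal.ofReal (2 - κ) := by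
  have hlayer : ∀ {p : ℝ → ℝ}, Measurable p → (∀ u ∈ Set.Icc (0 : ℝ) 1, 0 ≤ p u) →
      IsLUB (p '' Set.Icc 0 1) 1 →
      (∫⁻ u in Set.Icc (0 : ℝ) 1, ENNReal.ofReal (p u)) =
        ∫⁻ t in Set.Ioo (0 : ℝ) 1, volume ({u | t < p u} ∩ Set.Icc 0 1) := by
    intro p hp hp0 hp1
    rw [lintegral_eq_lintegral_meas_lt _
      ((ae_restrict_iff' measurableSet_Icc).2 (ae_of_all _ hp0)) hp.aemeasurable]
    have hz : ∀ t ∈ Set.Ici (1 : ℝ), volume ({u | t < p u} ∩ Set.Icc 0 1) = 0 := by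
      intro t ht
      convert measure_empty (μ := volume)
      refine Set.eq_empty_iff_forall_notMem.2 fun u hu => ?_
      have := hp1.1 (Set.mem_image_of_mem p hu.2)
      have h1 : t < p u := hu.1
      have h2 : (1 : ℝ) ≤ t := ht
      linarith
    have hr : ∀ t : ℝ, (volume.restrict (Set.Icc (0 : ℝ) 1)) {u | t < p u} =
        volume ({u | t < p u} ∩ Set.Icc 0 1) := fun t =>
      Measure.restrict_apply (measurableSet_lt measurable_const hp)
    simp_rw [hr]
    rw [← Set.Ioo_union_Ici_eq_Ioi (zero_lt_one' ℝ), lintegral_union measurableSet_Ici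
      (Set.disjoint_left.2 fun x hx hx' => not_lt.2 hx' hx.2),
      setLIntegral_congr_fun (g := 0) measurableSet_Ici hz]
    simp
  rw [hlayer hp hp0 hp1, hlayer hq hq0 hq1, ← lintegral_add_left]
  swap
  · exact Antitone.measurable fun s t hst =>
      measure_mono fun u hu => ⟨lt_of_le_of_lt hst hu.1, hu.2⟩
  calc ∫⁻ t in Set.Ioo (0 : ℝ) 1, (volume ({u | t < p u} ∩ Set.Icc 0 1) +
        volume ({u | t < q u} ∩ Set.Icc 0 1))
      ≤ ∫⁻ t in Set.Ioo (0 : ℝ) 1, ENNReal.ofReal (2 - 2 * (t * κ)) := by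
        -- Below the common supremum 1 both superlevel sets are nonempty, and p u > t, q v > t force
        -- (u + v)/2 ≥ tκ by the hypothesis.
        refine setLIntegral_mono (by fun_prop) fun t ht => ?_
        have hne : ∀ {p : ℝ → ℝ}, IsLUB (p '' Set.Icc 0 1) 1 →
            ({u | t < p u} ∩ Set.Icc 0 1).Nonempty := fun {p} hp1 => by
          obtain ⟨_, ⟨u, hu, rfl⟩, hut, -⟩ := hp1.exists_between ht.2
          exact ⟨u, hut, hu⟩
        refine volume_add_volume_le Set.inter_subset_right Set.inter_subset_right (hne hp1)
          (hne hq1) fun u hu v hv => ?_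
        have h1 := h u hu.2 v hv.2
        have hpu : t < p u := hu.1
        have hqv : t < q v := hv.1
        have h2 : (t * κ) ^ 2 ≤ ((u + v) / 2) ^ 2 := by
          refine le_trans ?_ h1
          have : t * t ≤ p u * q v := mul_le_mul hpu.le hqv.le ht.1.le (ht.1.le.trans hpu.le)
          nlinarith [sq_nonneg κ]
        have := abs_le_of_sq_le_sq h2 (by linarith [hu.2.1, hv.2.1])
        linarith [(le_abs_self _).trans this]
    _ = ENNReal.ofReal (∫ t in Set.Ioo (0 : ℝ) 1, (2 - 2 * (t * κ))) := by
        rw [ofReal_integral_eq_lintegral_ofReal]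
        · exact (Continuous.integrableOn_Icc (by fun_prop)).mono_set Set.Ioo_subset_Icc_self
        · refine (ae_restrict_iff' measurableSet_Ioo).2 (ae_of_all _ fun t ht => ?_)
          have := mul_le_one₀ ht.2.le hκ0 hκ1
          simp only [Pi.zero_apply]
          linarith
    _ = ENNReal.ofReal (2 - κ) := by
        congr 1
        rw [← integral_Ioc_eq_integral_Ioo, ← intervalIntegral.integral_of_le zero_le_one]
        have : ∀ t : ℝ, 2 - 2 * (t * κ) = 2 - (2 * κ) * t := fun t => by ring
        simp_rw [this]
        rw [intervalIntegral.integral_sub (by simp)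
          ((by fun_prop : Continuous fun t : ℝ => 2 * κ * t).intervalIntegrable _ _),
          intervalIntegral.integral_const_mul]
        simp
        ring

/-- One-dimensional Prékopa–Leindler inequality on `[0,1]` with the identity as the dominating
function. -/
theorem lintegral_mul_lintegral_le {p q : ℝ → ℝ} (hp : Measurable p) (hq : Measurable q)
    (hp0 : ∀ u ∈ Set.Icc (0 : ℝ) 1, 0 ≤ p u) (hq0 : ∀ u ∈ Set.Icc (0 : ℝ) 1, 0 ≤ q u)
    (hpb : BddAbove (p '' Set.Icc 0 1)) (hqb : BddAbove (q '' Set.Icc 0 1))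
    {K : ℝ} (hK : 0 < K)
    (h : ∀ u ∈ Set.Icc (0 : ℝ) 1, ∀ v ∈ Set.Icc (0 : ℝ) 1, p u * q v ≤ K * ((u + v) / 2) ^ 2) :
    (∫⁻ u in Set.Icc (0 : ℝ) 1, ENNReal.ofReal (p u)) *
      (∫⁻ u in Set.Icc (0 : ℝ) 1, ENNReal.ofReal (q u)) ≤ ENNReal.ofReal (K / 4) := by
  have hne : (Set.Icc (0 : ℝ) 1).Nonempty := ⟨0, by simp⟩
  have hla := isLUB_csSup (hne.image p) hpb
  have hlb := isLUB_csSup (hne.image q) hqb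
  set a := sSup (p '' Set.Icc 0 1)
  set b := sSup (q '' Set.Icc 0 1)
  have hpa : ∀ u ∈ Set.Icc (0 : ℝ) 1, p u ≤ a := fun u hu => hla.1 (Set.mem_image_of_mem p hu)
  have hqb : ∀ u ∈ Set.Icc (0 : ℝ) 1, q u ≤ b := fun u hu => hlb.1 (Set.mem_image_of_mem q hu)
  have ha0 : 0 ≤ a := (hp0 0 (by simp)).trans (hpa 0 (by simp))
  have hb0 : 0 ≤ b := (hq0 0 (by simp)).trans (hqb 0 (by simp))
  have hzero : ∀ {p : ℝ → ℝ}, (∀ u ∈ Set.Icc (0 : ℝ) 1, p u ≤ 0) →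
      ∫⁻ u in Set.Icc (0 : ℝ) 1, ENNReal.ofReal (p u) = 0 := fun {p} hp => by
    rw [setLIntegral_congr_fun (g := 0) measurableSet_Icc
      fun u hu => ENNReal.ofReal_eq_zero.2 (hp u hu)]
    simp
  rcases ha0.eq_or_lt with ha | ha
  · rw [hzero fun u hu => (hpa u hu).trans_eq ha.symm]; simp
  rcases hb0.eq_or_lt with hb | hb
  · rw [hzero fun u hu => (hqb u hu).trans_eq hb.symm]; simp
  have hlub : ∀ {p : ℝ → ℝ} {a : ℝ}, 0 < a → IsLUB (p '' Set.Icc 0 1) a →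
      IsLUB ((fun u => a⁻¹ * p u) '' Set.Icc 0 1) 1 := fun {p a} ha hla => by
    refine ⟨?_, fun c hc => ?_⟩
    · rintro _ ⟨u, hu, rfl⟩
      have := hla.1 (Set.mem_image_of_mem p hu)
      rw [inv_mul_le_iff₀ ha]
      simpa using this
    · have : a ≤ a * c := hla.2 (by
        rintro _ ⟨u, hu, rfl⟩
        have : a⁻¹ * p u ≤ c := hc ⟨u, hu, rfl⟩
        rwa [inv_mul_le_iff₀ ha] at this)
      nlinarith
  have habK : a * b ≤ K := by
    have h1 : ∀ u ∈ Set.Icc (0 : ℝ) 1, ∀ v ∈ Set.Icc (0 : ℝ) 1, p u * q v ≤ K := by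
      intro u hu v hv
      refine (h u hu v hv).trans ?_
      have : ((u + v) / 2) ^ 2 ≤ 1 := by
        have := hu.1; have := hu.2; have := hv.1; have := hv.2
        nlinarith
      nlinarith
    have h2 : ∀ u ∈ Set.Icc (0 : ℝ) 1, p u * b ≤ K := by
      intro u hu
      rcases (hp0 u hu).eq_or_lt with h0 | h0
      · rw [← h0]; simpa using hK.le
      · rw [mul_comm, ← le_div_iff₀ h0]
        refine hlb.2 ?_
        rintro _ ⟨v, hv, rfl⟩
        rw [le_div_iff₀ h0, mul_comm]
        exact h1 u hu v hv
    rw [← le_div_iff₀ hb]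
    refine hla.2 ?_
    rintro _ ⟨u, hu, rfl⟩
    rw [le_div_iff₀ hb]
    exact h2 u hu
  -- Dividing p and q by their suprema a and b turns the hypothesis into the normalised one with
  -- this κ; it is at most 1 because ab ≤ K.
  set κ := Real.sqrt (a * b / K)
  have hκ2 : κ ^ 2 = a * b / K := Real.sq_sqrt (by positivity)
  have hκ1 : κ ≤ 1 := Real.sqrt_le_one.2 (by rw [div_le_one hK]; exact habK)
  have hκ0 : 0 ≤ κ := Real.sqrt_nonneg _
  have key := lintegral_add_lintegral_le (p := fun u => a⁻¹ * p u) (q := fun u => b⁻¹ * q u)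
    (hp.const_mul _) (hq.const_mul _)
    (fun u hu => mul_nonneg (inv_nonneg.2 ha0) (hp0 u hu))
    (fun u hu => mul_nonneg (inv_nonneg.2 hb0) (hq0 u hu)) (hlub ha hla) (hlub hb hlb) hκ0 hκ1
    (fun u hu v hv => by
      have := h u hu v hv
      rw [hκ2]
      calc a * b / K * (a⁻¹ * p u * (b⁻¹ * q v)) = p u * q v / K := by field_simp
        _ ≤ ((u + v) / 2) ^ 2 := by rw [div_le_iff₀ hK]; linarith)
  have hscale : ∀ {p : ℝ → ℝ} {a : ℝ}, 0 < a →
      ∫⁻ u in Set.Icc (0 : ℝ) 1, ENNReal.ofReal (p u) =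
        ENNReal.ofReal a * ∫⁻ u in Set.Icc (0 : ℝ) 1, ENNReal.ofReal (a⁻¹ * p u) := by
    intro p a ha
    rw [← lintegral_const_mul' _ _ ENNReal.ofReal_ne_top]
    refine lintegral_congr fun u => ?_
    rw [← ENNReal.ofReal_mul ha.le, mul_inv_cancel_left₀ ha.ne']
  rw [hscale (p := p) ha, hscale (p := q) hb]
  set I := ∫⁻ u in Set.Icc (0 : ℝ) 1, ENNReal.ofReal (a⁻¹ * p u)
  set J := ∫⁻ u in Set.Icc (0 : ℝ) 1, ENNReal.ofReal (b⁻¹ * q u)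
  have hI : I ≠ ⊤ := ne_top_of_le_ne_top ENNReal.ofReal_ne_top (le_self_add.trans key)
  have hJ : J ≠ ⊤ := ne_top_of_le_ne_top ENNReal.ofReal_ne_top (le_add_self.trans key)
  rw [← ENNReal.ofReal_toReal hI, ← ENNReal.ofReal_toReal hJ] at key ⊢
  have hI0 : 0 ≤ I.toReal := ENNReal.toReal_nonneg
  have hJ0 : 0 ≤ J.toReal := ENNReal.toReal_nonneg
  generalize I.toReal = x at *
  generalize J.toReal = y at *
  rw [← ENNReal.ofReal_add hI0 hJ0, ENNReal.ofReal_le_ofReal_iff (by linarith)] at key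
  rw [← ENNReal.ofReal_mul ha0, ← ENNReal.ofReal_mul hb0, ← ENNReal.ofReal_mul (by positivity)]
  refine ENNReal.ofReal_le_ofReal ?_
  have hab : a * b = κ ^ 2 * K := by rw [hκ2]; field_simp
  -- AM–GM passes from the sum of the integrals to their product. Restoring the scale ab = κ²K
  -- leaves K(κ(2 - κ)/2)², and κ(2 - κ) ≤ 1.
  have h1 : x * y ≤ ((2 - κ) / 2) ^ 2 := by nlinarith [sq_nonneg (x - y)]
  have h2 : κ * ((2 - κ) / 2) ≤ 1 / 2 := by nlinarith [sq_nonneg (κ - 1)]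
  have h3 : 0 ≤ κ * ((2 - κ) / 2) := mul_nonneg hκ0 (by linarith)
  calc a * x * (b * y) = (κ ^ 2 * K) * (x * y) := by rw [← hab]; ring
    _ ≤ (κ ^ 2 * K) * ((2 - κ) / 2) ^ 2 := by gcongr
    _ = K * (κ * ((2 - κ) / 2)) ^ 2 := by ring
    _ ≤ K * (1 / 2) ^ 2 := by gcongr
    _ = K / 4 := by ring

/-- The defect in AM–GM is ((u - v)/2)², which on [0,1] is at least (u - v)²/4 times ((u + v)/2)².
With 1 - x ≤ e^(-x), that defect absorbs the exponential. It is the gain from log-concavity of the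
density 2u. -/
theorem mul_mul_exp_le {u v : ℝ} (hu : u ∈ Set.Icc (0 : ℝ) 1) (hv : v ∈ Set.Icc (0 : ℝ) 1) :
    u * v * Real.exp ((u - v) ^ 2 / 4) ≤ ((u + v) / 2) ^ 2 := by
  have h1 : u * v ≤ ((u + v) / 2) ^ 2 * (1 - (u - v) ^ 2 / 4) := by
    have : ((u + v) / 2) ^ 2 ≤ 1 := by
      have := hu.1; have := hu.2; have := hv.1; have := hv.2
      nlinarith
    nlinarith [sq_nonneg (u - v)]
  have h2 := Real.add_one_le_exp (-((u - v) ^ 2 / 4))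
  calc u * v * Real.exp ((u - v) ^ 2 / 4)
      ≤ ((u + v) / 2) ^ 2 * Real.exp (-((u - v) ^ 2 / 4)) * Real.exp ((u - v) ^ 2 / 4) := by
        refine mul_le_mul_of_nonneg_right (h1.trans ?_) (Real.exp_pos _).le
        gcongr
        linarith
    _ = ((u + v) / 2) ^ 2 := by rw [mul_assoc, ← Real.exp_add]; simp

/-- The substitution x = u²: the square root of a uniform variable has density 2u. -/
theorem lintegral_Icc_eq_sq (f : ℝ → ENNReal) :
    ∫⁻ x in Set.Icc (0 : ℝ) 1, f x =
      ∫⁻ u in Set.Icc (0 : ℝ) 1, ENNReal.ofReal |2 * u| * f (u ^ 2) := by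
  have himg : (fun u : ℝ => u ^ 2) '' Set.Icc 0 1 = Set.Icc 0 1 := by
    ext x
    constructor
    · rintro ⟨u, hu, rfl⟩
      exact ⟨sq_nonneg u, pow_le_one₀ hu.1 hu.2⟩
    · intro hx
      exact ⟨Real.sqrt x, ⟨Real.sqrt_nonneg x, Real.sqrt_le_one.2 hx.2⟩, Real.sq_sqrt hx.1⟩
  conv_lhs => rw [← himg]
  refine lintegral_image_eq_lintegral_abs_deriv_mul measurableSet_Icc (fun u _ => ?_) ?_ f
  · simpa using (hasDerivAt_pow 2 u).hasDerivWithinAt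
  · intro u hu v hv h
    exact (pow_left_inj₀ hu.1 hv.1 two_ne_zero).1 h

/-- Transport-type inequality for the uniform law in the metric `|√x - √y|`. -/
theorem lintegral_unif_mul_le {f g : ℝ → ENNReal} (hf : Measurable f) (hg : Measurable g)
    {c : ENNReal} (hc : c ≠ ⊤) (hfc : ∀ x, f x ≤ c) (hgc : ∀ x, g x ≤ c) {K : ℝ} (hK : 0 < K)
    (h : ∀ x ∈ Set.Icc (0 : ℝ) 1, ∀ y ∈ Set.Icc (0 : ℝ) 1,
      f x * g y ≤ ENNReal.ofReal (K * Real.exp ((√x - √y) ^ 2 / 4))) :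
    (∫⁻ x in Set.Icc (0 : ℝ) 1, f x) * (∫⁻ x in Set.Icc (0 : ℝ) 1, g x) ≤ ENNReal.ofReal K := by
  have hpush : ∀ {f : ℝ → ENNReal}, (∀ x, f x ≤ c) → ∫⁻ x in Set.Icc (0 : ℝ) 1, f x =
      2 * ∫⁻ u in Set.Icc (0 : ℝ) 1, ENNReal.ofReal (u * (f (u ^ 2)).toReal) := by
    intro f hfc
    rw [lintegral_Icc_eq_sq, ← lintegral_const_mul' _ _ (by simp)]
    refine setLIntegral_congr_fun measurableSet_Icc fun u hu => ?_
    have : f (u ^ 2) ≠ ⊤ := ne_top_of_le_ne_top hc (hfc _)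
    rw [abs_of_nonneg (by linarith [hu.1]), ENNReal.ofReal_mul hu.1, ENNReal.ofReal_toReal this,
      ENNReal.ofReal_mul zero_le_two, mul_assoc]
    simp
  have hbdd : ∀ {f : ℝ → ENNReal}, (∀ x, f x ≤ c) →
      BddAbove ((fun u => u * (f (u ^ 2)).toReal) '' Set.Icc 0 1) := by
    intro f hfc
    refine ⟨c.toReal, ?_⟩
    rintro _ ⟨u, hu, rfl⟩
    have := ENNReal.toReal_mono hc (hfc (u ^ 2))
    have h0 : 0 ≤ (f (u ^ 2)).toReal := ENNReal.toReal_nonneg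
    have := hu.2
    simp only
    nlinarith
  have hmeas : ∀ {f : ℝ → ENNReal}, Measurable f →
      Measurable fun u : ℝ => u * (f (u ^ 2)).toReal := fun hf =>
    measurable_id.mul (hf.comp (measurable_id.pow_const 2)).ennreal_toReal
  have key := lintegral_mul_lintegral_le (hmeas hf) (hmeas hg)
    (fun u hu => mul_nonneg hu.1 ENNReal.toReal_nonneg)
    (fun u hu => mul_nonneg hu.1 ENNReal.toReal_nonneg) (hbdd hfc) (hbdd hgc) hK
    (fun u hu v hv => by
      have hsq : ∀ {u : ℝ}, u ∈ Set.Icc (0 : ℝ) 1 → u ^ 2 ∈ Set.Icc (0 : ℝ) 1 :=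
        fun hu => ⟨sq_nonneg _, pow_le_one₀ hu.1 hu.2⟩
      have h1 := h _ (hsq hu) _ (hsq hv)
      rw [Real.sqrt_sq hu.1, Real.sqrt_sq hv.1] at h1
      have h2 := ENNReal.toReal_mono ENNReal.ofReal_ne_top h1
      rw [ENNReal.toReal_mul, ENNReal.toReal_ofReal (by positivity)] at h2
      calc u * (f (u ^ 2)).toReal * (v * (g (v ^ 2)).toReal)
          = u * v * ((f (u ^ 2)).toReal * (g (v ^ 2)).toReal) := by ring
        _ ≤ u * v * (K * Real.exp ((u - v) ^ 2 / 4)) :=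
          mul_le_mul_of_nonneg_left h2 (mul_nonneg hu.1 hv.1)
        _ = K * (u * v * Real.exp ((u - v) ^ 2 / 4)) := by ring
        _ ≤ K * ((u + v) / 2) ^ 2 := by gcongr; exact mul_mul_exp_le hu hv)
  -- The two factors 2 from the density cancel the 1/4 of the Prékopa–Leindler step.
  rw [hpush hfc, hpush hgc, mul_mul_mul_comm]
  refine (mul_le_mul_right key _).trans_eq ?_
  rw [show (2 : ENNReal) * 2 = ENNReal.ofReal 4 by norm_num, ← ENNReal.ofReal_mul (by norm_num)]
  congr 1
  ring

section Transport

variable {ι : Type*} [Fintype ι] [DecidableEq ι]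

/-- Tensorisation: integrating out one more coordinate uses the one-dimensional inequality with the
other coordinates frozen, and removes exactly that coordinate's term from the exponent. -/
theorem lmarginal_unif_mul_le {f g : (ι → ℝ) → ENNReal} (hf : Measurable f) (hg : Measurable g)
    {c : ENNReal} (hc : c ≠ ⊤) (hfc : ∀ x, f x ≤ c) (hgc : ∀ x, g x ≤ c)
    (h : ∀ x y : ι → ℝ, (∀ i, x i ∈ Set.Icc (0 : ℝ) 1) → (∀ i, y i ∈ Set.Icc (0 : ℝ) 1) →
      f x * g y ≤ ENNReal.ofReal (Real.exp (∑ i, (√(x i) - √(y i)) ^ 2 / 4)))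
    (s : Finset ι) :
    ∀ x y : ι → ℝ, (∀ i, x i ∈ Set.Icc (0 : ℝ) 1) → (∀ i, y i ∈ Set.Icc (0 : ℝ) 1) →
      lmarginal (fun _ => volume.restrict (Set.Icc (0 : ℝ) 1)) s f x *
        lmarginal (fun _ => volume.restrict (Set.Icc (0 : ℝ) 1)) s g y ≤
        ENNReal.ofReal (Real.exp (∑ i ∈ sᶜ, (√(x i) - √(y i)) ^ 2 / 4)) := by
  induction s using Finset.induction with
  | empty => simpa using h
  | insert i s hi ih =>
    intro x y hx hy
    have hbound : ∀ {f : (ι → ℝ) → ENNReal}, (∀ x, f x ≤ c) → ∀ x,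
        lmarginal (fun _ => volume.restrict (Set.Icc (0 : ℝ) 1)) s f x ≤ c := by
      intro f hfc x
      refine (lintegral_mono fun y => hfc _).trans ?_
      simp
    rw [lmarginal_insert f hf hi, lmarginal_insert g hg hi]
    refine lintegral_unif_mul_le ((hf.lmarginal _).comp (measurable_update x))
      ((hg.lmarginal _).comp (measurable_update y)) hc (fun _ => hbound hfc _)
      (fun _ => hbound hgc _) (Real.exp_pos _) fun t ht r hr => ?_
    have hup : ∀ {x : ι → ℝ} {t : ℝ}, (∀ i, x i ∈ Set.Icc (0 : ℝ) 1) → t ∈ Set.Icc (0 : ℝ) 1 →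
        ∀ j, Function.update x i t j ∈ Set.Icc (0 : ℝ) 1 := by
      intro x t hx ht j
      by_cases hj : j = i
      · subst hj; simpa using ht
      · simpa [hj] using hx j
    refine (ih _ _ (hup hx ht) (hup hy hr)).trans_eq ?_
    have hcompl : sᶜ = insert i (insert i s)ᶜ := by
      ext j; by_cases hj : j = i <;> simp [hj, hi]
    rw [hcompl, Finset.sum_insert (by simp), add_comm, Real.exp_add]
    simp only [Function.update_self]
    congr 3
    refine Finset.sum_congr rfl fun j hj => ?_
    have hji : j ≠ i := by rintro rfl; simp at hj
    simp [hji]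

/-- Dimension-free transport-type inequality for independent uniform variables. -/
theorem lintegral_pi_unif_mul_le {f g : (ι → ℝ) → ENNReal} (hf : Measurable f)
    (hg : Measurable g) {c : ENNReal} (hc : c ≠ ⊤) (hfc : ∀ x, f x ≤ c) (hgc : ∀ x, g x ≤ c)
    (h : ∀ x y : ι → ℝ, (∀ i, x i ∈ Set.Icc (0 : ℝ) 1) → (∀ i, y i ∈ Set.Icc (0 : ℝ) 1) →
      f x * g y ≤ ENNReal.ofReal (Real.exp (∑ i, (√(x i) - √(y i)) ^ 2 / 4))) :
    (∫⁻ x, f x ∂Measure.pi fun _ => volume.restrict (Set.Icc (0 : ℝ) 1)) *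
      (∫⁻ x, g x ∂Measure.pi fun _ => volume.restrict (Set.Icc (0 : ℝ) 1)) ≤ 1 := by
  simpa using lmarginal_unif_mul_le hf hg hc hfc hgc h Finset.univ 0 0 (by simp) (by simp)

/-- Two sets at distance `D` in the metric `‖√x - √y‖₂`. -/
theorem measure_pi_unif_mul_le {A B : Set (ι → ℝ)} (hA : MeasurableSet A) (hB : MeasurableSet B)
    {D : ℝ} (hD : 0 < D)
    (h : ∀ x ∈ A, ∀ y ∈ B, (∀ i, x i ∈ Set.Icc (0 : ℝ) 1) → (∀ i, y i ∈ Set.Icc (0 : ℝ) 1) →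
      D ^ 2 ≤ ∑ i, (√(x i) - √(y i)) ^ 2) :
    letI P := Measure.pi fun _ : ι => volume.restrict (Set.Icc (0 : ℝ) 1)
    P.real A * P.real B * Real.exp (D ^ 2 / 4) ≤ (1 - P.real A) * (1 - P.real B) := by
  set P := Measure.pi fun _ : ι => volume.restrict (Set.Icc (0 : ℝ) 1) with hP
  set E := Real.exp (D ^ 2 / 4) with hE
  have hE1' : 1 < E := Real.one_lt_exp_iff.2 (by positivity)
  have hE1 := hE1'.le
  classical
  -- Here f is E on B and 1 elsewhere, g is 1 on A and 1/E elsewhere. The product f x * g y exceeds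
  -- 1 only for x in B and y in A, where the distance D pays for E.
  let f : (ι → ℝ) → ENNReal := fun x => 1 + B.indicator (fun _ => ENNReal.ofReal (E - 1)) x
  let g : (ι → ℝ) → ENNReal := fun x => ENNReal.ofReal E⁻¹ +
    A.indicator (fun _ => ENNReal.ofReal (1 - E⁻¹)) x
  have hEi : E⁻¹ ≤ 1 := inv_le_one_of_one_le₀ hE1
  have hfB : ∀ x ∈ B, f x = ENNReal.ofReal E := fun x hx => by
    simp only [f, Set.indicator_of_mem hx]
    rw [← ENNReal.ofReal_one, ← ENNReal.ofReal_add zero_le_one (by linarith)]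
    congr 1; ring
  have hfB' : ∀ x ∉ B, f x = 1 := fun x hx => by simp [f, hx]
  have hgA : ∀ x ∈ A, g x = 1 := fun x hx => by
    simp only [g, Set.indicator_of_mem hx]
    rw [← ENNReal.ofReal_one, ← ENNReal.ofReal_add (by positivity) (by linarith)]
    congr 1; ring
  have hgA' : ∀ x ∉ A, g x = ENNReal.ofReal E⁻¹ := fun x hx => by simp [g, hx]
  have hle1 : ENNReal.ofReal E⁻¹ ≤ 1 := ENNReal.ofReal_le_one.2 hEi
  have h1le : 1 ≤ ENNReal.ofReal E := ENNReal.one_le_ofReal.2 hE1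
  have key := lintegral_pi_unif_mul_le (f := f) (g := g)
    ((measurable_const.indicator hB).const_add _)
    ((measurable_const.indicator hA).const_add _) (c := ENNReal.ofReal E)
    ENNReal.ofReal_ne_top
    (fun x => by
      by_cases hx : x ∈ B
      · exact (hfB x hx).le
      · rwa [hfB' x hx])
    (fun x => by
      by_cases hx : x ∈ A
      · rwa [hgA x hx]
      · rw [hgA' x hx]; exact hle1.trans h1le)
    (fun x y hx hy => by
      have hone : 1 ≤ ENNReal.ofReal (Real.exp (∑ i, (√(x i) - √(y i)) ^ 2 / 4)) :=
        ENNReal.one_le_ofReal.2 (Real.one_le_exp (Finset.sum_nonneg fun i _ => by positivity))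
      by_cases hxB : x ∈ B
      · by_cases hyA : y ∈ A
        · rw [hfB x hxB, hgA y hyA, mul_one]
          refine ENNReal.ofReal_le_ofReal (Real.exp_le_exp.2 ?_)
          have := h y hyA x hxB hy hx
          rw [← Finset.sum_div]
          have hs : ∑ i, (√(y i) - √(x i)) ^ 2 = ∑ i, (√(x i) - √(y i)) ^ 2 :=
            Finset.sum_congr rfl fun i _ => by ring
          rw [hs] at this
          linarith
        · rw [hfB x hxB, hgA' y hyA, ← ENNReal.ofReal_mul (by positivity),
            mul_inv_cancel₀ (by positivity)]
          simpa using hone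
      · rw [hfB' x hxB, one_mul]
        refine le_trans ?_ hone
        by_cases hyA : y ∈ A
        · rw [hgA y hyA]
        · rwa [hgA' y hyA])
  have hfi : ∫⁻ x, f x ∂P = ENNReal.ofReal (1 + (E - 1) * P.real B) := by
    simp only [f]
    rw [lintegral_add_left measurable_const, lintegral_indicator_const hB,
      ENNReal.ofReal_add zero_le_one (mul_nonneg (by linarith) measureReal_nonneg),
      ENNReal.ofReal_mul (by linarith), measureReal_def, ENNReal.ofReal_toReal (measure_ne_top _ _)]
    simp
  have hgi : ∫⁻ x, g x ∂P = ENNReal.ofReal (E⁻¹ + (1 - E⁻¹) * P.real A) := by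
    simp only [g]
    rw [lintegral_add_left measurable_const, lintegral_indicator_const hA,
      ENNReal.ofReal_add (by positivity) (mul_nonneg (by linarith) measureReal_nonneg),
      ENNReal.ofReal_mul (by linarith), measureReal_def, ENNReal.ofReal_toReal (measure_ne_top _ _)]
    simp
  have hpos : 0 ≤ 1 + (E - 1) * P.real B :=
    add_nonneg zero_le_one (mul_nonneg (by linarith) measureReal_nonneg)
  change (∫⁻ x, f x ∂P) * (∫⁻ x, g x ∂P) ≤ 1 at key
  rw [hfi, hgi, ← ENNReal.ofReal_mul hpos, ENNReal.ofReal_le_one] at key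
  generalize P.real A = α at *
  generalize P.real B = γ at *
  have hE0 : 0 < E := by positivity
  -- Expanding and dividing by E - 1 > 0 gives the claim.
  have h2 : (1 + (E - 1) * γ) * (1 + (E - 1) * α) ≤ E := by
    have h3 : (1 + (E - 1) * γ) * (E⁻¹ + (1 - E⁻¹) * α) =
        ((1 + (E - 1) * γ) * (1 + (E - 1) * α)) / E := by field_simp
    rwa [h3, div_le_one hE0] at key
  by_contra! hcon
  nlinarith

end Transport

/-! ### Concentration of the minimum cost around its median. -/

/-- The triangle inequality for the Euclidean norm of (√W e) over e in S. -/
theorem sqrt_cost_le {d n : ℕ} {W W' : Edge d n → ℝ} (hW : ∀ e, 0 ≤ W e) (hW' : ∀ e, 0 ≤ W' e)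
    (S : Finset (Edge d n)) :
    √(cost W' S) ≤ √(cost W S) + √(∑ e, (√(W' e) - √(W e)) ^ 2) := by
  have hnorm : ∀ {W : Edge d n → ℝ}, (∀ e, 0 ≤ W e) →
      √(cost W S) = ‖(WithLp.toLp 2 fun e : S => √(W e) : EuclideanSpace ℝ S)‖ := by
    intro W hW
    rw [EuclideanSpace.norm_eq, cost, ← Finset.sum_coe_sort]
    congr 1
    refine Finset.sum_congr rfl fun e _ => ?_
    rw [Real.norm_eq_abs, sq_abs, Real.sq_sqrt (hW e)]
  have htri := norm_add_le (WithLp.toLp 2 fun e : S => √(W e) : EuclideanSpace ℝ S)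
    (WithLp.toLp 2 fun e : S => √(W' e) - √(W e))
  have hadd : (WithLp.toLp 2 fun e : S => √(W e) : EuclideanSpace ℝ S) +
      (WithLp.toLp 2 fun e : S => √(W' e) - √(W e)) = WithLp.toLp 2 fun e : S => √(W' e) := by
    ext e; simp
  rw [hadd, ← hnorm hW', ← hnorm hW] at htri
  refine htri.trans (add_le_add_right ?_ _)
  rw [EuclideanSpace.norm_eq]
  refine Real.sqrt_le_sqrt ?_
  simp only [Real.norm_eq_abs, sq_abs]
  rw [Finset.sum_coe_sort S fun e => (√(W' e) - √(W e)) ^ 2]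
  exact Finset.sum_le_sum_of_subset_of_nonneg (Finset.subset_univ _) fun e _ _ => sq_nonneg _

theorem sqrt_minCost_le {d n : ℕ} (hd : 1 ≤ d) (hn : d + 2 ≤ n) {W W' : Edge d n → ℝ}
    (hW : ∀ e, 0 ≤ W e) (hW' : ∀ e, 0 ≤ W' e) :
    √(minCost W') ≤ √(minCost W) + √(∑ e, (√(W' e) - √(W e)) ^ 2) := by
  obtain ⟨S, hS, h⟩ := exists_minCost_eq hd hn W
  rw [h]
  exact (Real.sqrt_le_sqrt (minCost_le W' hS)).trans (sqrt_cost_le hW hW' S)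

theorem measurable_minCost {d n : ℕ} (hd : 1 ≤ d) (hn : d + 2 ≤ n) :
    Measurable (minCost : (Edge d n → ℝ) → ℝ) := by
  classical
  have hfin : (spheres d n).Finite := Set.toFinite _
  have hne : hfin.toFinset.Nonempty := by simpa using spheres_nonempty hd hn
  have : (minCost : (Edge d n → ℝ) → ℝ) = fun W => hfin.toFinset.inf' hne (cost W) := by
    funext W
    refine le_antisymm (Finset.le_inf' _ _ fun S hS => minCost_le W (by simpa using hS)) ?_
    obtain ⟨S, hS, h⟩ := exists_minCost_eq hd hn W
    rw [h]
    exact Finset.inf'_le _ (by simpa using hS)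
  rw [this]
  refine Continuous.measurable (Continuous.finset_inf'_apply _ fun S _ => ?_)
  exact continuous_finsetSum _ fun e _ => continuous_apply e

/-- Isoperimetry for the level sets of the minimum cost. -/
theorem minCost_isoperimetry {d n : ℕ} (hd : 1 ≤ d) (hn : d + 2 ≤ n) {a b : ℝ} (ha : 0 ≤ a)
    (hab : a < b) :
    (costLaw d n).real {W | minCost W ≤ a} * (costLaw d n).real {W | b ≤ minCost W} *
        Real.exp ((√b - √a) ^ 2 / 4) ≤
      (1 - (costLaw d n).real {W | minCost W ≤ a}) *
        (1 - (costLaw d n).real {W | b ≤ minCost W}) := by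
  have hm := measurable_minCost hd hn
  have hlt : √a < √b := Real.sqrt_lt_sqrt ha hab
  refine measure_pi_unif_mul_le (measurableSet_le hm measurable_const)
    (measurableSet_le measurable_const hm) (by linarith) fun x hx y hy hx01 hy01 => ?_
  have hx : minCost x ≤ a := hx
  have hy : b ≤ minCost y := hy
  have h1 := sqrt_minCost_le hd hn (fun e => (hx01 e).1) (fun e => (hy01 e).1)
  have h2 := Real.sqrt_le_sqrt hx
  have h3 := Real.sqrt_le_sqrt hy
  have hs : ∑ e, (√(y e) - √(x e)) ^ 2 = ∑ e, (√(x e) - √(y e)) ^ 2 :=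
    Finset.sum_congr rfl fun i _ => by ring
  rw [hs] at h1
  rw [← Real.le_sqrt (by linarith) (Finset.sum_nonneg fun e _ => sq_nonneg _)]
  linarith

/-- Since α ≥ 1/2, the hypothesis gives γ(1 + e^x) ≤ 1, and 1 + e^x ≥ 2e^(x/2). The factor 1/2 lets
the two tails add up without a leading constant. -/
theorem le_half_exp_of_isoperimetry {α γ x : ℝ} (hα : 1 / 2 ≤ α) (hγ : 0 ≤ γ)
    (hγ1 : γ ≤ 1) (h : α * γ * Real.exp x ≤ (1 - α) * (1 - γ)) :
    γ ≤ 1 / 2 * Real.exp (-(x / 2)) := by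
  have hx : Real.exp x = Real.exp (x / 2) * Real.exp (x / 2) := by
    rw [← Real.exp_add]; congr 1; ring
  have he := Real.exp_pos (x / 2)
  rw [Real.exp_neg, ← div_eq_mul_inv, le_div_iff₀ he]
  rw [hx] at h
  set E := Real.exp (x / 2)
  have h1 : γ * (E * E) ≤ 1 - γ := by
    have h2 : 1 / 2 * (γ * (E * E)) ≤ α * (γ * (E * E)) := by gcongr
    have h3 : (1 - α) * (1 - γ) ≤ 1 / 2 * (1 - γ) := by
      apply mul_le_mul_of_nonneg_right <;> linarith
    nlinarith
  nlinarith [mul_nonneg hγ (sq_nonneg (E - 1))]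

theorem sub_div_le_sqrt_sub_sqrt {a b c : ℝ} (ha : 0 ≤ a) (hab : a < b) (hbc : b ≤ c) :
    (b - a) ^ 2 / (4 * c) ≤ (√b - √a) ^ 2 := by
  have hc : 0 < c := by linarith
  rw [div_le_iff₀ (by linarith)]
  have h1 : b - a = (√b - √a) * (√b + √a) := by
    nlinarith [Real.sq_sqrt ha, Real.sq_sqrt (ha.trans hab.le)]
  have h2 : (√b + √a) ^ 2 ≤ 4 * c := by
    nlinarith [Real.sq_sqrt ha, Real.sq_sqrt (ha.trans hab.le), sq_nonneg (√b - √a)]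
  rw [h1, mul_pow]
  gcongr

/-- Concentration around the median. Since `√(minCost W)` is `1`-Lipschitz in `√W` and the minimum
cost is at most `d * n`, no bound on the number of facets of the optimal sphere is needed. -/
theorem minCost_concentration {d n : ℕ} (hd : 2 ≤ d) (hn : d + 2 ≤ n) {μ : ℝ}
    (hμ : IsMedian (costLaw d n) minCost μ) {t : ℝ} (ht : 0 < t) :
    (costLaw d n).real {W | t < |minCost W - μ|} ≤
      Real.exp (-(1 / (64 * d) * t ^ 2 / n)) := by
  set P := costLaw d n with hP
  have hd0 : (0 : ℝ) < d := by exact_mod_cast (by omega : 0 < d)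
  have hn0 : (0 : ℝ) < n := by exact_mod_cast (by omega : 0 < n)
  have hae : ∀ᵐ W ∂P, 0 ≤ minCost W ∧ minCost W ≤ d * n := by
    filter_upwards [ae_costLaw_mem d n] with W hW
    exact ⟨minCost_nonneg fun e => (hW e).1,
      minCost_le_mul hd hn (fun e => (hW e).1) fun e => (hW e).2⟩
  -- An event of probability at least 1/2 meets the almost sure event 0 ≤ `minCost` ≤ d n; this
  -- confines the median to [0, d n].
  have hpos : ∀ {s : Set (Edge d n → ℝ)}, 1 / 2 ≤ P.real s →
      ∃ W ∈ s, 0 ≤ minCost W ∧ minCost W ≤ d * n := by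
    intro s hs
    by_contra! hcon
    have : P s = 0 := by
      refine measure_mono_null (fun W hW => ?_) (ae_iff.1 hae)
      simp only [Set.mem_ofPred_eq, not_and, not_le]
      exact hcon W hW
    rw [measureReal_def, this] at hs
    norm_num at hs
  have hμ0 : 0 ≤ μ := by
    obtain ⟨W, hW, h0, -⟩ := hpos hμ.1
    exact h0.trans hW
  have hμ1 : μ ≤ d * n := by
    obtain ⟨W, hW, -, h1⟩ := hpos hμ.2
    exact le_trans hW h1
  have hzero : ∀ {s : Set (Edge d n → ℝ)},
      (∀ W ∈ s, 0 ≤ minCost W → minCost W ≤ d * n → False) → P.real s = 0 := by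
    intro s hs
    have : P s = 0 := by
      refine measure_mono_null (fun W hW => ?_) (ae_iff.1 hae)
      intro h
      exact hs W hW h.1 h.2
    rw [measureReal_def, this]
    simp
  have hd1 : 1 ≤ d := by omega
  have hexp : ∀ {a b : ℝ}, 0 ≤ a → a < b → b - a = t → b ≤ 2 * (d * n) →
      Real.exp (-((√b - √a) ^ 2 / 4 / 2)) ≤ Real.exp (-(1 / (64 * d) * t ^ 2 / n)) := by
    intro a b ha hab hba hb
    refine Real.exp_le_exp.2 (neg_le_neg ?_)
    have := sub_div_le_sqrt_sub_sqrt ha hab hb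
    rw [hba] at this
    -- The 64 is 8 · 8: one 8 from 4 · (2dn) in the comparison of square roots, the other from the 4
    -- in the isoperimetric exponent and its halving.
    calc 1 / (64 * d) * t ^ 2 / n = t ^ 2 / (4 * (2 * (d * n))) / 4 / 2 := by field_simp; norm_num
      _ ≤ (√b - √a) ^ 2 / 4 / 2 := by gcongr
  have hup : P.real {W | μ + t ≤ minCost W} ≤
      1 / 2 * Real.exp (-(1 / (64 * d) * t ^ 2 / n)) := by
    by_cases htn : μ + t ≤ 2 * (d * n)
    · have h1 := minCost_isoperimetry hd1 hn hμ0 (by linarith : μ < μ + t)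
      refine (le_half_exp_of_isoperimetry hμ.1 measureReal_nonneg
        measureReal_le_one h1).trans ?_
      gcongr 1 / 2 * ?_
      exact hexp hμ0 (by linarith) (by ring) htn
    · rw [hzero]
      · positivity
      · intro W hW h0 h1
        have hW : μ + t ≤ minCost W := hW
        nlinarith
  have hlow : P.real {W | minCost W ≤ μ - t} ≤
      1 / 2 * Real.exp (-(1 / (64 * d) * t ^ 2 / n)) := by
    by_cases htn : 0 ≤ μ - t
    · have h1 := minCost_isoperimetry hd1 hn htn (by linarith : μ - t < μ)
      -- For the lower tail the upper level set is the one of measure at least 1/2, so the two sets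
      -- exchange roles.
      rw [mul_comm (P.real _) (P.real _), mul_comm (1 - _)] at h1
      refine (le_half_exp_of_isoperimetry hμ.2 measureReal_nonneg
        measureReal_le_one h1).trans ?_
      gcongr 1 / 2 * ?_
      exact hexp htn (by linarith) (by ring) (by nlinarith)
    · rw [hzero]
      · positivity
      · intro W hW h0 h1
        have hW : minCost W ≤ μ - t := hW
        linarith
  calc P.real {W | t < |minCost W - μ|}
      ≤ P.real ({W | μ + t ≤ minCost W} ∪ {W | minCost W ≤ μ - t}) := by
        refine measureReal_mono fun W hW => ?_
        have hW : t < |minCost W - μ| := hW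
        rcases lt_abs.1 hW with h | h
        · exact Or.inl (by simp only [Set.mem_ofPred_eq]; linarith)
        · exact Or.inr (by simp only [Set.mem_ofPred_eq]; linarith)
    _ ≤ _ := measureReal_union_le _ _
    _ ≤ Real.exp (-(1 / (64 * d) * t ^ 2 / n)) := by linarith

/-! ### Lower bound by a union bound over spheres. -/

theorem integral_exp_neg_unif_le {l : ℝ} (hl : 0 < l) :
    ∫ x in Set.Icc (0 : ℝ) 1, Real.exp (-l * x) ≤ l⁻¹ := by
  rw [integral_Icc_eq_integral_Ioc, ← intervalIntegral.integral_of_le zero_le_one,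
    intervalIntegral.integral_comp_mul_left (f := Real.exp) (by linarith : -l ≠ 0), integral_exp]
  have := Real.exp_pos (-l)
  simp only [mul_one, mul_zero, Real.exp_zero, smul_eq_mul]
  rw [inv_neg, neg_mul, ← mul_neg]
  have h1 : -(Real.exp (-l) - 1) ≤ 1 := by linarith
  nlinarith [inv_pos.2 hl]

/-- Lower tail of a sum of independent uniform variables. -/
theorem cost_lower_tail {d n : ℕ} (S : Finset (Edge d n)) (hS : 0 < S.card) {s : ℝ} (hs : 0 < s) :
    (costLaw d n).real {W | cost W S ≤ s} ≤ (Real.exp 1 * s / S.card) ^ S.card := by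
  classical
  have hm : (0 : ℝ) < S.card := by exact_mod_cast hS
  -- The parameter minimising e^(ls) l^(-m), where m is the number of facets.
  set l : ℝ := S.card / s with hl
  have hl0 : 0 < l := by positivity
  let h : Edge d n → ℝ → ℝ := fun e x => if e ∈ S then Real.exp (-l * x) else 1
  have hprod : ∀ W : Edge d n → ℝ, ∏ e, h e (W e) = Real.exp (-l * cost W S) := by
    intro W
    simp only [h]
    rw [Finset.prod_ite_mem, Finset.univ_inter, ← Real.exp_sum, cost, Finset.mul_sum]
  have hint : ∀ e, Integrable (h e) (volume.restrict (Set.Icc (0 : ℝ) 1)) := by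
    intro e
    simp only [h]
    split_ifs
    · exact Continuous.integrableOn_Icc (by fun_prop)
    · exact integrable_const _
  have hI : Integrable (fun W : Edge d n → ℝ => ∏ e, h e (W e)) (costLaw d n) :=
    Integrable.fintype_prod hint
  have hval : ∫ W, ∏ e, h e (W e) ∂costLaw d n ≤ (l⁻¹) ^ S.card := by
    rw [costLaw, integral_fintype_prod_eq_prod]
    calc ∏ e, ∫ x in Set.Icc (0 : ℝ) 1, h e x
        = ∏ e, if e ∈ S then ∫ x in Set.Icc (0 : ℝ) 1, Real.exp (-l * x) else 1 := by
          refine Finset.prod_congr rfl fun e _ => ?_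
          simp only [h]
          split_ifs <;> simp
      _ = (∫ x in Set.Icc (0 : ℝ) 1, Real.exp (-l * x)) ^ S.card := by
          rw [Finset.prod_ite_mem, Finset.univ_inter, Finset.prod_const]
      _ ≤ _ := by
          gcongr
          exact integral_exp_neg_unif_le hl0
  have hmarkov := mul_meas_ge_le_integral_of_nonneg
    (ae_of_all _ fun W => by simp only [hprod]; exact (Real.exp_pos _).le) hI (Real.exp (-l * s))
  have hset : {W : Edge d n → ℝ | cost W S ≤ s} ⊆
      {W | Real.exp (-l * s) ≤ ∏ e, h e (W e)} := by
    intro W hW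
    have hW : cost W S ≤ s := hW
    simp only [Set.mem_ofPred_eq, hprod]
    refine Real.exp_le_exp.2 ?_
    nlinarith
  have h1 := (mul_le_mul_of_nonneg_left (measureReal_mono hset)
    (Real.exp_pos (-l * s)).le).trans (hmarkov.trans hval)
  have hls : -l * s = -(S.card : ℝ) := by rw [hl]; field_simp
  rw [hls, Real.exp_neg, inv_mul_le_iff₀ (Real.exp_pos _)] at h1
  refine h1.trans_eq ?_
  rw [hl, inv_div, mul_div_assoc, mul_pow, ← Real.exp_nat_mul, mul_one]

theorem card_le_of_mem_spheres {d n : ℕ} {S : Finset (Edge d n)} (hS : S ∈ spheres d n) :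
    n ≤ S.card * (d + 1) := by
  have h : (Finset.univ : Finset (Fin n)) ⊆ S.biUnion fun e => e.1 := by
    intro v _
    obtain ⟨e, he, hv⟩ := hS.1 v
    exact Finset.mem_biUnion.2 ⟨e, he, hv⟩
  have h1 := (Finset.card_le_card h).trans (Finset.card_biUnion_le_card_mul S _ (d + 1)
    fun e _ => e.2.le)
  simpa using h1

theorem tendsto_measure_of_compl {Ω : ℕ → Type*} [∀ n, MeasurableSpace (Ω n)]
    {P : ∀ n, Measure (Ω n)} [∀ n, IsProbabilityMeasure (P n)] {A : ∀ n, Set (Ω n)} {u : ℕ → ℝ}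
    (hu : Tendsto u atTop (𝓝 0)) (h : ∀ᶠ n in atTop, (P n).real (A n)ᶜ ≤ u n) :
    Tendsto (fun n => P n (A n)) atTop (𝓝 1) := by
  have hlow : Tendsto (fun n => ENNReal.ofReal (1 - u n)) atTop (𝓝 1) := by
    have := (ENNReal.continuous_ofReal.tendsto (1 - 0)).comp (hu.const_sub 1)
    simpa [Function.comp_def] using this
  refine tendsto_of_tendsto_of_tendsto_of_le_of_le' hlow tendsto_const_nhds ?_
    (Eventually.of_forall fun n => prob_le_one)
  filter_upwards [h] with n hn
  rw [← ENNReal.ofReal_toReal (measure_ne_top (P n) (A n))]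
  refine ENNReal.ofReal_le_ofReal ?_
  have h1 := measureReal_union_le (μ := P n) (A n) (A n)ᶜ
  rw [Set.union_compl_self, probReal_univ, measureReal_def] at h1
  linarith

theorem sum_half_pow_le (s : Finset ℕ) {k : ℕ} (hs : ∀ m ∈ s, k ≤ m) :
    ∑ m ∈ s, (1 / 2 : ℝ) ^ m ≤ 2 * (1 / 2) ^ k := by
  calc ∑ m ∈ s, (1 / 2 : ℝ) ^ m = (1 / 2) ^ k * ∑ m ∈ s, (1 / 2 : ℝ) ^ (m - k) := by
        rw [Finset.mul_sum]
        refine Finset.sum_congr rfl fun m hm => ?_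
        rw [← pow_add, Nat.add_sub_cancel' (hs m hm)]
    _ = (1 / 2) ^ k * ∑ j ∈ s.image (· - k), (1 / 2 : ℝ) ^ j := by
        rw [Finset.sum_image]
        intro a ha b hb hab
        have := hs a ha
        have := hs b hb
        simp only at hab
        omega
    _ ≤ (1 / 2) ^ k * 2 := by
        gcongr
        exact (summable_geometric_two.sum_le_tsum _ fun j _ => by positivity).trans_eq
          tsum_geometric_two
    _ = _ := by ring

/-- The product is at most an m-th power with base 2^C m^β · e a n^(1-β)/m. Since n ≤ m(d + 1) and 1
- β ≥ 0, the powers of m cancel, and `haC` brings the base down to 1/2. -/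
theorem count_mul_tail_le {d n m : ℕ} {C β a N : ℝ} (hβ : β ≤ 1) (ha : 0 < a) (hm : 0 < m)
    (hnm : n ≤ m * (d + 1))
    (haC : (2 : ℝ) ^ C * Real.exp 1 * a * (d + 1 : ℝ) ^ (1 - β) ≤ 1 / 2)
    (hN : N ≤ (2 : ℝ) ^ (C * m) * (m : ℝ) ^ (β * m)) :
    N * (Real.exp 1 * (a * (n : ℝ) ^ (1 - β)) / m) ^ m ≤ (1 / 2) ^ m := by
  have hm0 : (0 : ℝ) < m := by exact_mod_cast hm
  have h1 : (2 : ℝ) ^ (C * m) * (m : ℝ) ^ (β * m) = ((2 : ℝ) ^ C * (m : ℝ) ^ β) ^ m := by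
    rw [mul_pow, ← Real.rpow_mul_natCast (by norm_num), ← Real.rpow_mul_natCast hm0.le]
  have hn : (n : ℝ) ≤ m * (d + 1) := by exact_mod_cast hnm
  have h2 : (n : ℝ) ^ (1 - β) ≤ (m : ℝ) ^ (1 - β) * (d + 1 : ℝ) ^ (1 - β) := by
    rw [← Real.mul_rpow hm0.le (by positivity)]
    exact Real.rpow_le_rpow (by positivity) hn (by linarith)
  have h3 : (m : ℝ) ^ β * (m : ℝ) ^ (1 - β) = m := by
    rw [← Real.rpow_add hm0]; simp
  calc N * (Real.exp 1 * (a * (n : ℝ) ^ (1 - β)) / m) ^ m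
      ≤ ((2 : ℝ) ^ C * (m : ℝ) ^ β) ^ m * (Real.exp 1 * (a * (n : ℝ) ^ (1 - β)) / m) ^ m := by
        rw [← h1]
        gcongr
    _ = ((2 : ℝ) ^ C * (m : ℝ) ^ β * (Real.exp 1 * (a * (n : ℝ) ^ (1 - β)) / m)) ^ m :=
        (mul_pow _ _ _).symm
    _ ≤ (1 / 2) ^ m := by
        refine pow_le_pow_left₀ (by positivity) ?_ m
        calc (2 : ℝ) ^ C * (m : ℝ) ^ β * (Real.exp 1 * (a * (n : ℝ) ^ (1 - β)) / m)
            ≤ (2 : ℝ) ^ C * (m : ℝ) ^ β *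
              (Real.exp 1 * (a * ((m : ℝ) ^ (1 - β) * (d + 1 : ℝ) ^ (1 - β))) / m) := by gcongr
          _ = (2 : ℝ) ^ C * Real.exp 1 * a * (d + 1 : ℝ) ^ (1 - β) *
              ((m : ℝ) ^ β * (m : ℝ) ^ (1 - β)) / m := by ring
          _ = (2 : ℝ) ^ C * Real.exp 1 * a * (d + 1 : ℝ) ^ (1 - β) := by
              rw [h3]; field_simp
          _ ≤ 1 / 2 := haC

/-- Spheres are grouped by facet number m. Covering n vertices forces m ≥ n/(d + 1), so only a
geometric tail remains. -/
theorem measureReal_minCost_lt_le {d n : ℕ} (hd : 1 ≤ d) (hn : d + 2 ≤ n) {C β a : ℝ}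
    (hβ : β ≤ 1) (ha : 0 < a)
    (haC : (2 : ℝ) ^ C * Real.exp 1 * a * (d + 1 : ℝ) ^ (1 - β) ≤ 1 / 2)
    (hC : ∀ m : ℕ, (({S | S ∈ spheres d n ∧ S.card = m} : Set (Finset (Edge d n))).ncard : ℝ)
      ≤ (2 : ℝ) ^ (C * m) * (m : ℝ) ^ (β * m)) :
    (costLaw d n).real {W | a * (n : ℝ) ^ (1 - β) ≤ minCost W}ᶜ ≤ 2 * (1 / 2) ^ (n / (d + 1)) := by
  classical
  set s : ℝ := a * (n : ℝ) ^ (1 - β) with hs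
  have hn0 : (0 : ℝ) < n := by exact_mod_cast (by omega : 0 < n)
  have hs0 : 0 < s := by positivity
  have hfin : (spheres d n).Finite := Set.toFinite _
  let T : Finset (Finset (Edge d n)) := hfin.toFinset
  have hT : ∀ S, S ∈ T ↔ S ∈ spheres d n := fun S => by simp [T]
  have hsub : {W : Edge d n → ℝ | s ≤ minCost W}ᶜ ⊆ ⋃ S ∈ T, {W | cost W S ≤ s} := by
    intro W hW
    have hW : ¬ s ≤ minCost W := hW
    obtain ⟨S, hS, h⟩ := exists_minCost_eq hd hn W
    refine Set.mem_biUnion ((hT S).2 hS) ?_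
    change cost W S ≤ s
    rw [← h]; linarith
  have hcard : ∀ S ∈ T, n ≤ S.card * (d + 1) := fun S hS => card_le_of_mem_spheres ((hT S).1 hS)
  have hcard0 : ∀ S ∈ T, 0 < S.card := fun S hS => by
    have h1 := hcard S hS
    refine Nat.pos_of_ne_zero fun h0 => ?_
    rw [h0] at h1
    omega
  calc (costLaw d n).real {W | s ≤ minCost W}ᶜ
      ≤ (costLaw d n).real (⋃ S ∈ T, {W | cost W S ≤ s}) := 
        measureReal_mono hsub (measure_ne_top _ _)
    _ ≤ ∑ S ∈ T, (costLaw d n).real {W | cost W S ≤ s} := measureReal_biUnion_finset_le _ _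
    _ ≤ ∑ S ∈ T, (Real.exp 1 * s / S.card) ^ S.card :=
        Finset.sum_le_sum fun S hS => cost_lower_tail S (hcard0 S hS) hs0
    _ = ∑ m ∈ T.image Finset.card, ∑ S ∈ T with S.card = m, (Real.exp 1 * s / S.card) ^ S.card :=
        (Finset.sum_fiberwise_of_maps_to (fun S hS => Finset.mem_image_of_mem _ hS) _).symm
    _ ≤ ∑ m ∈ T.image Finset.card, (1 / 2 : ℝ) ^ m := by
        refine Finset.sum_le_sum fun m hm => ?_
        obtain ⟨S, hS, rfl⟩ := Finset.mem_image.1 hm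
        refine le_trans (le_of_eq ?_) (count_mul_tail_le hβ ha (hcard0 S hS) (hcard S hS) haC
          (hC S.card))
        rw [Finset.sum_congr rfl (g := fun _ => (Real.exp 1 * s / S.card) ^ S.card)
          fun S' hS' => by rw [(Finset.mem_filter.1 hS').2], Finset.sum_const, nsmul_eq_mul]
        congr 2
        rw [← Set.ncard_coe_finset]
        congr 1
        ext S'
        simp [hT]
    _ ≤ 2 * (1 / 2) ^ (n / (d + 1)) := by
        refine sum_half_pow_le _ fun m hm => ?_
        obtain ⟨S, hS, rfl⟩ := Finset.mem_image.1 hm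
        exact Nat.div_le_of_le_mul (by rw [mul_comm]; exact hcard S hS)

theorem exists_tendsto_lower {d : ℕ} (hd : 1 ≤ d) {β : ℝ} (hβ : IsCountExponent d β)
    (hβ1 : β ≤ 1) :
    ∃ a : ℝ, 0 < a ∧ Tendsto
      (fun n : ℕ => costLaw d n {W | a * (n : ℝ) ^ (1 - β) ≤ minCost W}) atTop (𝓝 1) := by
  obtain ⟨C, hC⟩ := hβ
  set q : ℝ := (2 : ℝ) ^ C * Real.exp 1 * (d + 1 : ℝ) ^ (1 - β) with hq
  have hq0 : 0 < q := by positivity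
  refine ⟨1 / 2 / q, by positivity, ?_⟩
  have hlim : Tendsto (fun n : ℕ => 2 * (1 / 2 : ℝ) ^ (n / (d + 1))) atTop (𝓝 0) := by
    have h1 : Tendsto (fun n : ℕ => n / (d + 1)) atTop atTop :=
      Nat.tendsto_div_const_atTop (by omega)
    have h2 := (tendsto_pow_atTop_nhds_zero_of_lt_one (by norm_num : (0 : ℝ) ≤ 1 / 2)
      (by norm_num)).comp h1
    simpa using h2.const_mul 2
  refine tendsto_measure_of_compl hlim ?_
  filter_upwards [eventually_ge_atTop (d + 2)] with n hn
  refine measureReal_minCost_lt_le hd hn hβ1 (by positivity) (le_of_eq ?_) (hC n)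
  calc (2 : ℝ) ^ C * Real.exp 1 * (1 / 2 / q) * (d + 1 : ℝ) ^ (1 - β) = 1 / 2 / q * q := by
        rw [hq]; ring
    _ = 1 / 2 := by field_simp

/-! ### Upper bound through the exponential moment of the greedy process. -/

section Marginal

variable {ι : Type*} [Fintype ι] [DecidableEq ι] {X : ι → Type*} [∀ i, MeasurableSpace (X i)]
  {μ : ∀ i, Measure (X i)} [∀ i, IsProbabilityMeasure (μ i)]

theorem lmarginal_eq_lintegral {s : Finset ι} {g : (∀ i, X i) → ENNReal} (hg : Measurable g)
    (hdep : ∀ x y, (∀ i ∈ s, x i = y i) → g x = g y) (x : ∀ i, X i) :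
    lmarginal μ s g x = ∫⁻ y, g y ∂Measure.pi μ := by
  have hconst : ∀ y, lmarginal μ s g y = lmarginal μ s g x := fun y => by
    refine lintegral_congr fun z => hdep _ _ fun i hi => ?_
    simp [Function.updateFinset_def, hi]
  rw [lintegral_eq_lmarginal_univ x, ← Finset.union_compl s,
    lmarginal_union' μ g hg disjoint_compl_right]
  change _ = ∫⁻ y, lmarginal μ s g _ ∂_
  simp_rw [hconst]
  simp

/-- The choice of an index may depend on the variables in `s`, the continuation on the others. -/
theorem lintegral_iInf_mul_le {κ : Type*} [Countable κ] {s : Finset ι} {R : Finset κ}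
    (hR : R.Nonempty) {p g : κ → (∀ i, X i) → ENNReal} (hp : ∀ v, Measurable (p v))
    (hg : ∀ v, Measurable (g v))
    (hps : ∀ v ∈ R, ∀ x y, (∀ i ∈ s, x i = y i) → p v x = p v y)
    (hgs : ∀ v ∈ R, ∀ x y, (∀ i ∉ s, x i = y i) → g v x = g v y)
    {B : ENNReal} (hB : ∀ v ∈ R, ∫⁻ x, g v x ∂Measure.pi μ ≤ B) :
    ∫⁻ x, ⨅ v ∈ R, p v x * g v x ∂Measure.pi μ ≤
      (∫⁻ x, ⨅ v ∈ R, p v x ∂Measure.pi μ) * B := by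
  classical
  have hpm : Measurable fun x => ⨅ v ∈ R, p v x :=
    Measurable.iInf fun v => Measurable.iInf fun _ => hp v
  rw [← lintegral_mul_const _ hpm]
  have hpg : Measurable fun x => ⨅ v ∈ R, p v x * g v x :=
    Measurable.iInf fun v => Measurable.iInf fun _ => (hp v).mul (hg v)
  -- Freeze the variables in s and integrate over the others. The minimiser v of p is then fixed,
  -- hence a legitimate choice, and the mean of its continuation is at most B.
  refine lintegral_le_of_lmarginal_le sᶜ hpg (hpm.mul_const _) fun x => ?_
  obtain ⟨v, hv, hmin⟩ := Finset.exists_mem_eq_inf R hR fun v => p v x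
  rw [Finset.inf_eq_iInf] at hmin
  have hupd : ∀ w ∈ R, ∀ z, p w (Function.updateFinset x sᶜ z) = p w x := fun w hw z =>
    hps w hw _ _ fun i hi => by simp [Function.updateFinset_def, hi]
  calc lmarginal μ sᶜ (fun x => ⨅ v ∈ R, p v x * g v x) x
      ≤ lmarginal μ sᶜ (fun y => p v x * g v y) x := by
        refine lintegral_mono fun z => (iInf₂_le v hv).trans_eq ?_
        rw [hupd v hv z]
    _ = p v x * lmarginal μ sᶜ (g v) x :=
        lintegral_const_mul _ ((hg v).comp measurable_updateFinset)
    _ ≤ p v x * B := by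
        gcongr
        rw [lmarginal_eq_lintegral (hg v)
          fun x y h => hgs v hv x y fun i hi => h i (Finset.mem_compl.2 hi)]
        exact hB v hv
    _ = lmarginal μ sᶜ (fun x => (⨅ v ∈ R, p v x) * B) x := by
        have : ∀ z, (⨅ w ∈ R, p w (Function.updateFinset x sᶜ z)) * B = p v x * B := fun z => by
          rw [← hmin]
          congr 1
          exact iInf_congr fun w => iInf_congr fun hw => hupd w hw z
        simp [lmarginal, this]

theorem lintegral_mul_le_of_dependsOn {s : Finset ι} {p g : (∀ i, X i) → ENNReal}
    (hp : Measurable p) (hg : Measurable g)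
    (hps : ∀ x y, (∀ i ∈ s, x i = y i) → p x = p y)
    (hgs : ∀ x y, (∀ i ∉ s, x i = y i) → g x = g y) :
    ∫⁻ x, p x * g x ∂Measure.pi μ ≤ (∫⁻ x, p x ∂Measure.pi μ) * ∫⁻ x, g x ∂Measure.pi μ := by
  simpa using lintegral_iInf_mul_le (R := {()}) (μ := μ) (by simp) (p := fun _ => p)
    (g := fun _ => g) (fun _ => hp) (fun _ => hg) (fun _ _ => hps) (fun _ _ => hgs)
    (fun _ _ => le_rfl)

end Marginal

theorem costLaw_forall_le {d n : ℕ} (T : Finset (Edge d n)) {s : ℝ} (hs0 : 0 ≤ s) (hs1 : s ≤ 1) :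
    costLaw d n {W | ∀ e ∈ T, W e ≤ s} = ENNReal.ofReal (s ^ T.card) := by
  classical
  have hset : {W : Edge d n → ℝ | ∀ e ∈ T, W e ≤ s} =
      Set.univ.pi fun e => if e ∈ T then Set.Iic s else Set.univ := by
    ext W
    simp only [Set.mem_ofPred_eq, Set.mem_pi, Set.mem_univ, true_implies]
    refine forall_congr' fun e => ?_
    by_cases he : e ∈ T <;> simp [he]
  have hvol : volume.restrict (Set.Icc (0 : ℝ) 1) (Set.Iic s) = ENNReal.ofReal s := by
    rw [Measure.restrict_apply measurableSet_Iic]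
    have : Set.Iic s ∩ Set.Icc 0 1 = Set.Icc 0 s := by
      ext x
      simp only [Set.mem_inter_iff, Set.mem_Iic, Set.mem_Icc]
      constructor
      · rintro ⟨h1, h2, -⟩; exact ⟨h2, h1⟩
      · rintro ⟨h1, h2⟩; exact ⟨h2, h1, h2.trans hs1⟩
    rw [this, Real.volume_Icc, sub_zero]
  rw [hset, costLaw, Measure.pi_pi]
  have : ∀ e, volume.restrict (Set.Icc (0 : ℝ) 1) (if e ∈ T then Set.Iic s else Set.univ) =
      if e ∈ T then ENNReal.ofReal s else 1 := fun e => by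
    split_ifs
    · exact hvol
    · exact measure_univ
  simp_rw [this]
  rw [Finset.prod_ite_mem, Finset.univ_inter, Finset.prod_const, ENNReal.ofReal_pow hs0]

/-- The facets bought when `F` is subdivided at `v`. -/
def boughtFacets {d n : ℕ} (F : Edge d n) (v : Fin n) : Finset (Edge d n) :=
  (F.1.erase (pivot F)).image fun u => swap F u v

theorem card_boughtFacets {d n : ℕ} {F : Edge d n} {v : Fin n} (hv : v ∉ F.1) :
    (boughtFacets F v).card = d := by
  rw [boughtFacets, Finset.card_image_of_injOn
    ((swap_injOn hv).mono (by simp)),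
    Finset.card_erase_of_mem (pivot_mem F), F.2]
  rfl

/-- Containing v makes the facet sets of different candidates disjoint; containing the pivot
separates this step from all later ones. -/
theorem mem_of_mem_boughtFacets {d n : ℕ} {F : Edge d n} {v : Fin n} (hv : v ∉ F.1)
    {e : Edge d n} (he : e ∈ boughtFacets F v) : v ∈ e.1 ∧ pivot F ∈ e.1 ∧ e.1 ⊆ insert v F.1 := by
  obtain ⟨u, hu, rfl⟩ := Finset.mem_image.1 he
  obtain ⟨hup, hu⟩ := Finset.mem_erase.1 hu
  rw [swap_val hu hv]
  refine ⟨by simp, by simp [pivot_mem F, hup.symm], ?_⟩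
  exact Finset.insert_subset_insert _ (Finset.erase_subset _ _)

theorem stepCost_le_of_boughtFacets {d n : ℕ} {W : Edge d n → ℝ} {F : Edge d n} {v : Fin n}
    {s : ℝ} (h : ∀ e ∈ boughtFacets F v, W e ≤ s) : stepCost W F v ≤ d * s := by
  refine (Finset.sum_le_card_nsmul _ _ s fun u hu => h _ (Finset.mem_image_of_mem _ hu)).trans_eq ?_
  rw [Finset.card_erase_of_mem (pivot_mem F), F.2]
  simp

theorem measurableSet_forall_le {d n : ℕ} (T : Finset (Edge d n)) (s : ℝ) :
    MeasurableSet {W : Edge d n → ℝ | ∀ e ∈ T, W e ≤ s} := by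
  have : {W : Edge d n → ℝ | ∀ e ∈ T, W e ≤ s} = ⋂ e ∈ T, {W | W e ≤ s} := by
    ext W; simp
  rw [this]
  exact Finset.measurableSet_biInter _ fun e _ =>
    measurableSet_le (measurable_pi_apply e) measurable_const

/-- All vertices of `R` are unsuitable with small probability. -/
theorem lintegral_prod_indicator_le {d n : ℕ} (F : Edge d n) {s : ℝ} (hs0 : 0 ≤ s) (hs1 : s ≤ 1)
    (R : Finset (Fin n)) (hR : Disjoint F.1 R) :
    ∫⁻ W, ∏ v ∈ R, ({W | ∀ e ∈ boughtFacets F v, W e ≤ s}ᶜ : Set (Edge d n → ℝ)).indicator 1 W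
      ∂costLaw d n ≤ ENNReal.ofReal (1 - s ^ d) ^ R.card := by
  classical
  have hdep : ∀ v {W W' : Edge d n → ℝ}, (∀ e ∈ boughtFacets F v, W e = W' e) →
      ({W | ∀ e ∈ boughtFacets F v, W e ≤ s}ᶜ : Set (Edge d n → ℝ)).indicator
        (1 : (Edge d n → ℝ) → ENNReal) W =
      ({W | ∀ e ∈ boughtFacets F v, W e ≤ s}ᶜ : Set (Edge d n → ℝ)).indicator 1 W' := by
    intro v W W' h
    have : W ∈ ({W | ∀ e ∈ boughtFacets F v, W e ≤ s}ᶜ : Set (Edge d n → ℝ)) ↔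
        W' ∈ ({W | ∀ e ∈ boughtFacets F v, W e ≤ s}ᶜ : Set (Edge d n → ℝ)) := by
      simp only [Set.mem_compl_iff, Set.mem_ofPred_eq]
      refine not_congr (forall₂_congr fun e he => ?_)
      rw [h e he]
    simp only [Set.indicator, this, Pi.one_apply]
  have hmeas : ∀ v, Measurable
      (({W | ∀ e ∈ boughtFacets F v, W e ≤ s}ᶜ : Set (Edge d n → ℝ)).indicator
        (1 : (Edge d n → ℝ) → ENNReal)) := fun v =>
    measurable_one.indicator (measurableSet_forall_le _ s).compl
  induction R using Finset.induction with
  | empty => simp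
  | insert v R hv ih =>
    have hvF : v ∉ F.1 := Finset.disjoint_right.1 hR (Finset.mem_insert_self _ _)
    have hRF : Disjoint F.1 R := hR.mono_right (Finset.subset_insert _ _)
    simp only [Finset.prod_insert hv]
    -- Split the costs by whether the hyperedge contains v: the facets for another candidate w lie
    -- in F ∪ {w} and avoid v.
    refine (lintegral_mul_le_of_dependsOn (s := Finset.univ.filter fun e : Edge d n => v ∈ e.1)
      (hmeas v) (Finset.measurable_prod _ fun w _ => hmeas w) ?_ ?_).trans ?_
    · intro W W' h
      exact hdep v fun e he => h e (by simpa using (mem_of_mem_boughtFacets hvF he).1)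
    · intro W W' h
      refine Finset.prod_congr rfl fun w hw => hdep w fun e he => h e ?_
      have hwF : w ∉ F.1 := Finset.disjoint_right.1 hRF hw
      intro hve
      have hve : v ∈ e.1 := by simpa using hve
      rcases Finset.mem_insert.1 ((mem_of_mem_boughtFacets hwF he).2.2 hve) with h1 | h1
      · exact hv (h1 ▸ hw)
      · exact hvF h1
    · rw [Finset.card_insert_of_notMem hv, pow_succ']
      refine mul_le_mul' (le_of_eq ?_) (ih hRF)
      change ∫⁻ W, _ ∂costLaw d n = _
      rw [lintegral_indicator_one (measurableSet_forall_le _ s).compl,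
        prob_compl_eq_one_sub (measurableSet_forall_le _ s), costLaw_forall_le _ hs0 hs1,
        card_boughtFacets hvF, ENNReal.ofReal_sub _ (by positivity), ENNReal.ofReal_one]

/-- The cheapest single insertion. -/
noncomputable def minStep {d n : ℕ} (F : Edge d n) (R : Finset (Fin n)) (hR : R.Nonempty)
    (W : Edge d n → ℝ) : ℝ := R.inf' hR fun v => stepCost W F v

theorem measurable_minStep {d n : ℕ} (F : Edge d n) (R : Finset (Fin n)) (hR : R.Nonempty) :
    Measurable (minStep F R hR) :=
  Continuous.measurable (Continuous.finset_inf'_apply _ fun _ _ =>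
    continuous_finsetSum _ fun _ _ => continuous_apply _)

/-- If a step costs more than t for every v, then each v has a facet dearer than t/d. These events
are independent, each of probability 1 - (t/d)^d, and 1 - x ≤ e^(-x). For t > d the event is null.
-/
theorem measure_lt_minStep_le {d n : ℕ} (hd : 1 ≤ d) (F : Edge d n) {R : Finset (Fin n)}
    (hR : R.Nonempty) (hFR : Disjoint F.1 R) {t : ℝ} (ht : 0 ≤ t) :
    costLaw d n {W | t < minStep F R hR W} ≤
      ENNReal.ofReal (Real.exp (-(R.card * (t / d) ^ d))) := by
  classical
  have hd0 : (0 : ℝ) < d := by exact_mod_cast hd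
  by_cases htd : t ≤ d
  · have hs0 : 0 ≤ t / d := by positivity
    have hs1 : t / d ≤ 1 := (div_le_one hd0).2 htd
    have h1 := lintegral_prod_indicator_le F hs0 hs1 R hFR
    have hm : MeasurableSet {W | t < minStep F R hR W} :=
      measurableSet_lt measurable_const (measurable_minStep F R hR)
    calc costLaw d n {W | t < minStep F R hR W}
        = ∫⁻ W, {W | t < minStep F R hR W}.indicator 1 W ∂costLaw d n :=
          (lintegral_indicator_one hm).symm
      _ ≤ _ := lintegral_mono fun W => ?_
      _ ≤ ENNReal.ofReal (1 - (t / d) ^ d) ^ R.card := h1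
      _ ≤ _ := ?_
    · by_cases hW : t < minStep F R hR W
      · rw [Finset.prod_congr rfl (g := fun _ => 1)]
        · simp only [Finset.prod_const_one]
          exact Set.indicator_le_self' (fun _ _ => bot_le) W |>.trans_eq rfl
        · intro v hv
          refine Set.indicator_of_mem ?_ _
          intro hle
          have h2 := stepCost_le_of_boughtFacets hle
          rw [mul_div_cancel₀ _ hd0.ne'] at h2
          exact absurd (hW.trans_le (Finset.inf'_le _ hv)) (not_lt.2 h2)
      · rw [Set.indicator_of_notMem (by simpa using hW)]
        exact bot_le
    · rw [← ENNReal.ofReal_pow (by have := pow_le_one₀ (n := d) hs0 hs1; linarith)]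
      refine ENNReal.ofReal_le_ofReal ?_
      have h3 : 1 - (t / d) ^ d ≤ Real.exp (-(t / d) ^ d) := by
        linarith [Real.add_one_le_exp (-(t / d) ^ d)]
      refine (pow_le_pow_left₀ (by have := pow_le_one₀ (n := d) hs0 hs1; linarith) h3 _).trans_eq ?_
      rw [← Real.exp_nat_mul]
      congr 1
      ring
  · have : costLaw d n {W | t < minStep F R hR W} = 0 := by
      refine measure_mono_null (fun W hW => ?_) (ae_iff.1 (ae_costLaw_mem d n))
      have hW : t < minStep F R hR W := hW
      intro hW1
      obtain ⟨v, hv⟩ := hR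
      have h2 : minStep F R ⟨v, hv⟩ W ≤ stepCost W F v := Finset.inf'_le _ hv
      have h3 := stepCost_le (b := 1) (fun e => (hW1 e).2) F v
      linarith
    rw [this]
    exact bot_le

theorem lintegral_minStep_le {d n : ℕ} (hd : 1 ≤ d) (F : Edge d n) {R : Finset (Fin n)}
    (hR : R.Nonempty) (hFR : Disjoint F.1 R) :
    ∫⁻ W, ENNReal.ofReal (minStep F R hR W) ∂costLaw d n ≤
      ENNReal.ofReal (d * Real.exp 1 * (R.card : ℝ) ^ (-(1 / d : ℝ))) := by
  have hd0 : (0 : ℝ) < d := by exact_mod_cast hd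
  have hr0 : (0 : ℝ) < R.card := by exact_mod_cast Finset.card_pos.2 hR
  -- The scale of the cheapest step, chosen so that |R| δ^d = 1; the tail at t = dδu is then
  -- e^(-u^d).
  set δ : ℝ := (R.card : ℝ) ^ (-(1 / d : ℝ)) with hδ
  have hδ0 : 0 < δ := by positivity
  have hδd : (R.card : ℝ) * δ ^ d = 1 := by
    rw [hδ, ← Real.rpow_mul_natCast hr0.le]
    have : -(1 / (d : ℝ)) * d = -1 := by field_simp
    rw [this, Real.rpow_neg_one, mul_inv_cancel₀ hr0.ne']
  have hnn : 0 ≤ᵐ[costLaw d n] minStep F R hR := by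
    filter_upwards [ae_costLaw_mem d n] with W hW
    exact Finset.le_inf' _ _ fun v _ => Finset.sum_nonneg fun u _ => (hW _).1
  rw [lintegral_eq_lintegral_meas_lt _ hnn (measurable_minStep F R hR).aemeasurable]
  have hl : 0 < (d * δ)⁻¹ := by positivity
  calc ∫⁻ t in Set.Ioi 0, costLaw d n {W | t < minStep F R hR W}
      ≤ ∫⁻ t in Set.Ioi (0 : ℝ), ENNReal.ofReal (Real.exp 1 * Real.exp (-(d * δ)⁻¹ * t)) := by
        refine setLIntegral_mono (by fun_prop) fun t ht => ?_
        have ht : 0 < t := ht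
        refine (measure_lt_minStep_le hd F hR hFR ht.le).trans (ENNReal.ofReal_le_ofReal ?_)
        rw [← Real.exp_add, Real.exp_le_exp]
        set u : ℝ := t / d / δ with hu
        have hu0 : 0 ≤ u := by positivity
        have h1 : (R.card : ℝ) * (t / d) ^ d = u ^ d := by
          have : t / d = u * δ := by rw [hu]; field_simp
          rw [this, mul_pow, mul_left_comm, hδd, mul_one]
        have h2 : (d * δ)⁻¹ * t = u := by rw [hu]; field_simp
        rw [h1, neg_mul, h2]
        -- The target -u^d ≤ 1 - u is clear for u ≤ 1 and follows from u ≤ u^d otherwise.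
        by_cases hu1 : u ≤ 1
        · have := pow_nonneg hu0 d
          linarith
        · have := le_self_pow₀ (not_le.1 hu1).le (by omega : d ≠ 0)
          linarith
    _ = ENNReal.ofReal (∫ t in Set.Ioi (0 : ℝ), Real.exp 1 * Real.exp (-(d * δ)⁻¹ * t)) := by
        rw [ofReal_integral_eq_lintegral_ofReal]
        · exact (exp_neg_integrableOn_Ioi 0 hl).const_mul _
        · exact ae_of_all _ fun t => by positivity
    _ = _ := by
        congr 1
        rw [integral_const_mul, integral_exp_mul_Ioi (by linarith) 0]
        simp
        ring

theorem lintegral_exp_step_le {d n : ℕ} (hd : 1 ≤ d) (F : Edge d n) {R : Finset (Fin n)}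
    (hR : R.Nonempty) (hFR : Disjoint F.1 R) :
    ∫⁻ W, ⨅ v ∈ R, ENNReal.ofReal (Real.exp (stepCost W F v)) ∂costLaw d n ≤
      ENNReal.ofReal
        (Real.exp (d * Real.exp (d + 1) * (R.card : ℝ) ^ (-(1 / d : ℝ)))) := by
  have hm := measurable_minStep F R hR
  calc ∫⁻ W, ⨅ v ∈ R, ENNReal.ofReal (Real.exp (stepCost W F v)) ∂costLaw d n
      ≤ ∫⁻ W, (1 + ENNReal.ofReal (Real.exp d) * ENNReal.ofReal (minStep F R hR W))
          ∂costLaw d n := by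
        refine lintegral_mono_ae ?_
        filter_upwards [ae_costLaw_mem d n] with W hW
        obtain ⟨v, hv, hmin⟩ := Finset.exists_mem_eq_inf' hR fun v => stepCost W F v
        refine (iInf₂_le v hv).trans ?_
        have hz : minStep F R hR W = stepCost W F v := hmin
        rw [hz]
        have h0 : 0 ≤ stepCost W F v := Finset.sum_nonneg fun u _ => (hW _).1
        have h1 : stepCost W F v ≤ d := by
          simpa using stepCost_le (b := 1) (fun e => (hW e).2) F v
        rw [← ENNReal.ofReal_mul (Real.exp_pos _).le, ← ENNReal.ofReal_one,
          ← ENNReal.ofReal_add zero_le_one (by positivity)]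
        refine ENNReal.ofReal_le_ofReal ?_
        set z := stepCost W F v
        -- From 1 - z ≤ e^(-z) comes e^z ≤ 1 + z e^z ≤ 1 + z e^d, so the mean of the cheapest step
        -- controls its exponential moment.
        have h2 := Real.add_one_le_exp (-z)
        have h3 : Real.exp z * Real.exp (-z) = 1 := by rw [← Real.exp_add]; simp
        have h4 : Real.exp z ≤ Real.exp d := Real.exp_le_exp.2 h1
        nlinarith [Real.exp_pos z]
    _ = 1 + ENNReal.ofReal (Real.exp d) *
          ∫⁻ W, ENNReal.ofReal (minStep F R hR W) ∂costLaw d n := by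
        rw [lintegral_add_left measurable_const, lintegral_const_mul _ hm.ennreal_ofReal]
        simp
    _ ≤ 1 + ENNReal.ofReal (Real.exp d) *
          ENNReal.ofReal (d * Real.exp 1 * (R.card : ℝ) ^ (-(1 / d : ℝ))) := by
        gcongr
        exact lintegral_minStep_le hd F hR hFR
    _ ≤ _ := by
        rw [← ENNReal.ofReal_mul (Real.exp_pos _).le, ← ENNReal.ofReal_one,
          ← ENNReal.ofReal_add zero_le_one (by positivity)]
        refine ENNReal.ofReal_le_ofReal ?_
        refine le_trans (le_of_eq ?_) (Real.add_one_le_exp _)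
        rw [Real.exp_add]
        ring

/-- The current step depends only on hyperedges through the pivot, the continuation only on the
others, so the moment bounds of the steps multiply. -/
theorem lintegral_insertionValue_le {d n : ℕ} (hd : 1 ≤ d) (r : ℕ) :
    ∀ {F : Edge d n} {R : Finset (Fin n)}, Disjoint F.1 R → R.card = r →
      ∫⁻ W, insertionValue r F R W ∂costLaw d n ≤ ENNReal.ofReal
        (Real.exp (d * Real.exp (d + 1) *
          ∑ k ∈ Finset.range r, ((k + 1 : ℕ) : ℝ) ^ (-(1 / d : ℝ)))) := by
  classical
  induction r with
  | zero => intro F R _ _; simp [insertionValue]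
  | succ r ih =>
    intro F R hFR hR
    have hne : R.Nonempty := Finset.card_pos.1 (by omega)
    have hstep := lintegral_exp_step_le hd F hne hFR
    refine (lintegral_iInf_mul_le (μ := fun _ : Edge d n => volume.restrict (Set.Icc (0 : ℝ) 1))
      (s := Finset.univ.filter fun e : Edge d n => pivot F ∈ e.1) hne
      (p := fun v W => ENNReal.ofReal (Real.exp (stepCost W F v)))
      (g := fun v W => insertionValue r (nextFacet F v) (R.erase v) W)
      (fun v => (Real.measurable_exp.comp (measurable_stepCost F v)).ennreal_ofReal)
      (fun v => measurable_insertionValue r _ _) ?_ ?_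
      (fun v hv => ih (nextFacet_disjoint hFR hv)
        (by rw [Finset.card_erase_of_mem hv, hR]; rfl))).trans ?_
    · intro v hv W W' h
      have hvF : v ∉ F.1 := Finset.disjoint_right.1 hFR hv
      have : stepCost W F v = stepCost W' F v := Finset.sum_congr rfl fun u hu => h _ (by
        simpa using (mem_of_mem_boughtFacets hvF (Finset.mem_image_of_mem _ hu)).2.1)
      simp only [this]
    · intro v hv W W' h
      refine insertionValue_congr r (nextFacet_disjoint hFR hv) fun e he => h e ?_
      intro hp
      have hp : pivot F ∈ e.1 := by simpa using hp
      exact (Finset.mem_erase.1 (nextFacet_union_subset hFR hv (he hp))).1 rfl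
    · refine (mul_le_mul_left hstep _).trans_eq ?_
      rw [← ENNReal.ofReal_mul (Real.exp_pos _).le, ← Real.exp_add, Finset.sum_range_succ, hR]
      congr 2
      ring

/-- With a = 1 - 1/d ≥ 1/2, Bernoulli's inequality gives 2(x^a - (x - 1)^a) ≥ 2a x^(a-1) ≥ x^(a-1),
which carries the induction. -/
theorem sum_rpow_neg_le {d : ℕ} (hd : 2 ≤ d) (r : ℕ) :
    ∑ k ∈ Finset.range r, ((k + 1 : ℕ) : ℝ) ^ (-(1 / d : ℝ)) ≤ 2 * (r : ℝ) ^ (1 - 1 / (d : ℝ)) := by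
  have hd0 : (2 : ℝ) ≤ d := by exact_mod_cast hd
  have hinv : 1 / (d : ℝ) ≤ 1 / 2 := one_div_le_one_div_of_le (by norm_num) hd0
  have hinv0 : 0 < 1 / (d : ℝ) := by positivity
  induction r with
  | zero => simp; positivity
  | succ r ih =>
    rw [Finset.sum_range_succ]
    set a : ℝ := 1 - 1 / (d : ℝ) with ha
    set x : ℝ := ((r + 1 : ℕ) : ℝ) with hx
    have hx0 : 0 < x := by positivity
    have hrx : (r : ℝ) = x * (1 + -x⁻¹) := by rw [hx]; push_cast; field_simp; ring
    have hx1 : 1 ≤ x := by rw [hx]; push_cast; linarith [(Nat.cast_nonneg r : (0 : ℝ) ≤ r)]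
    have hxi : x⁻¹ ≤ 1 := inv_le_one_of_one_le₀ hx1
    have h1 : (r : ℝ) ^ a ≤ x ^ a * (1 + a * -x⁻¹) := by
      rw [hrx, Real.mul_rpow hx0.le (by linarith)]
      gcongr
      exact rpow_one_add_le_one_add_mul_self (by linarith) (by linarith) (by linarith)
    have h2 : x ^ (-(1 / d : ℝ)) = x ^ a * x⁻¹ := by
      rw [← Real.rpow_neg_one x, ← Real.rpow_add hx0]
      congr 1
      rw [ha]; ring
    rw [h2]
    have h3 : 0 < x ^ a * x⁻¹ := by positivity
    have h4 : 1 / 2 ≤ a := by linarith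
    nlinarith

/-- Markov's inequality at level e^(4Kx), where K = d e^(d+1) and x = n^(1-1/d), for an exponential
of mean at most e^(2Kx). The extra (d + 3)x absorbs the additive d + 3, as x ≥ 1. -/
theorem measureReal_minCost_gt_le {d n : ℕ} (hd : 2 ≤ d) (hn : d + 2 ≤ n) :
    (costLaw d n).real {W | minCost W ≤
        (4 * (d * Real.exp (d + 1)) + (d + 3)) * (n : ℝ) ^ (1 - 1 / (d : ℝ))}ᶜ ≤
      Real.exp (-(2 * (d * Real.exp (d + 1)) * (n : ℝ) ^ (1 - 1 / (d : ℝ)))) := by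
  have hd0 : (2 : ℝ) ≤ d := by exact_mod_cast hd
  have hinv : 1 / (d : ℝ) ≤ 1 / 2 := one_div_le_one_div_of_le (by norm_num) hd0
  set K : ℝ := d * Real.exp (d + 1) with hK
  have hK0 : 0 < K := by positivity
  set x : ℝ := (n : ℝ) ^ (1 - 1 / (d : ℝ)) with hx
  have hn1 : (1 : ℝ) ≤ n := by exact_mod_cast (by omega : 1 ≤ n)
  have hx1 : 1 ≤ x := Real.one_le_rpow hn1 (by linarith)
  obtain ⟨F, R, hFR, hR, hI⟩ := exists_exp_minCost_le (d := d) (n := n) (by omega) hn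
  have hint := lintegral_insertionValue_le (d := d) (n := n) (by omega) (n - (d + 2)) hFR hR
  have hint2 : ∫⁻ W, insertionValue (n - (d + 2)) F R W ∂costLaw d n ≤
      ENNReal.ofReal (Real.exp (2 * K * x)) := by
    refine hint.trans (ENNReal.ofReal_le_ofReal (Real.exp_le_exp.2 ?_))
    have h1 := sum_rpow_neg_le hd (n - (d + 2))
    have h2 : ((n - (d + 2) : ℕ) : ℝ) ^ (1 - 1 / (d : ℝ)) ≤ x :=
      Real.rpow_le_rpow (by positivity) (by exact_mod_cast Nat.sub_le _ _) (by linarith)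
    calc K * _ ≤ K * (2 * x) := by gcongr; linarith
      _ = 2 * K * x := by ring
  have hmarkov := mul_meas_ge_le_lintegral (μ := costLaw d n)
    (measurable_insertionValue (n - (d + 2)) F R) (ENNReal.ofReal (Real.exp (4 * K * x)))
  have hsub : costLaw d n {W | minCost W ≤ (4 * K + (d + 3)) * x}ᶜ ≤
      costLaw d n {W | ENNReal.ofReal (Real.exp (4 * K * x)) ≤
        insertionValue (n - (d + 2)) F R W} := by
    refine measure_mono_ae ?_
    filter_upwards [ae_costLaw_mem d n] with W hW hWc
    have hWc : ¬ minCost W ≤ (4 * K + (d + 3)) * x := hWc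
    change ENNReal.ofReal (Real.exp (4 * K * x)) ≤ insertionValue (n - (d + 2)) F R W
    refine le_trans (ENNReal.ofReal_le_ofReal (Real.exp_le_exp.2 ?_))
      (hI W (fun e => (hW e).1) fun e => (hW e).2)
    nlinarith
  have h1 := (mul_le_mul_right hsub _).trans (hmarkov.trans hint2)
  rw [← ENNReal.ofReal_toReal (measure_ne_top (costLaw d n) _),
    ← ENNReal.ofReal_mul (Real.exp_pos _).le, ENNReal.ofReal_le_ofReal_iff (Real.exp_pos _).le,
    ← measureReal_def, mul_comm, ← le_div_iff₀ (Real.exp_pos _), ← Real.exp_sub] at h1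
  refine h1.trans_eq ?_
  congr 1
  ring

theorem exists_tendsto_upper {d : ℕ} (hd : 2 ≤ d) :
    ∃ b : ℝ, Tendsto
      (fun n : ℕ => costLaw d n {W | minCost W ≤ b * (n : ℝ) ^ (1 - 1 / (d : ℝ))})
      atTop (𝓝 1) := by
  have hd0 : (2 : ℝ) ≤ d := by exact_mod_cast hd
  have hinv : 1 / (d : ℝ) ≤ 1 / 2 := one_div_le_one_div_of_le (by norm_num) hd0
  refine ⟨4 * (d * Real.exp (d + 1)) + (d + 3), ?_⟩
  refine tendsto_measure_of_compl
    (u := fun n : ℕ => Real.exp (-(2 * (d * Real.exp (d + 1)) * (n : ℝ) ^ (1 - 1 / (d : ℝ))))) ?_ ?_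
  · refine Real.tendsto_exp_neg_atTop_nhds_zero.comp ?_
    refine Tendsto.const_mul_atTop (by positivity) ?_
    exact (tendsto_rpow_atTop (by linarith)).comp tendsto_natCast_atTop_atTop
  · filter_upwards [eventually_ge_atTop (d + 2)] with n hn
    exact measureReal_minCost_gt_le hd hn

end SpanningSphere

theorem theorem1p2 (d : ℕ) (hd : 2 ≤ d) :
    (∀ n : ℕ, d + 2 ≤ n → (SpanningSphere.spheres d n).Nonempty) ∧
    (∃ b : ℝ, Tendsto
      (fun n : ℕ => SpanningSphere.costLaw d n
        {W | SpanningSphere.minCost W ≤ b * (n : ℝ) ^ (1 - 1 / (d : ℝ))})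
      atTop (𝓝 1)) ∧
    (∀ β : ℝ, SpanningSphere.IsCountExponent d β → β ≤ 1 →
      ∃ a : ℝ, 0 < a ∧ Tendsto
        (fun n : ℕ => SpanningSphere.costLaw d n
          {W | a * (n : ℝ) ^ (1 - β) ≤ SpanningSphere.minCost W})
        atTop (𝓝 1)) ∧
    (∀ β : ℝ, SpanningSphere.IsCountExponent d β → β < 1 / 2 →
      ∃ c : ℝ, 0 < c ∧ ∀ n : ℕ, d + 2 ≤ n → ∀ μ : ℝ,
        SpanningSphere.IsMedian (SpanningSphere.costLaw d n) SpanningSphere.minCost μ →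
        ∀ t : ℝ, 0 < t →
          (SpanningSphere.costLaw d n).real {W | t < |SpanningSphere.minCost W - μ|}
            ≤ Real.exp (-(c * t ^ 2 / n))) := by
  have hd1 : 1 ≤ d := by omega
  refine ⟨fun n hn => SpanningSphere.spheres_nonempty hd1 hn,
    SpanningSphere.exists_tendsto_upper hd,
    fun β hβ hβ1 => SpanningSphere.exists_tendsto_lower hd1 hβ hβ1, fun _ _ _ => ?_⟩
  have hd0 : (0 : ℝ) < d := by exact_mod_cast (by omega : 0 < d)
  exact ⟨1 / (64 * d), by positivity, fun n hn μ hμ t ht =>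
    SpanningSphere.minCost_concentration hd hn hμ ht⟩
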